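/- Let $\lambda_M,\lambda_M',\lambda_E,\lambda_E',\gamma,p\in\mathbb R$ and $\Omega>0$. For $\varepsilon\in\mathbb R$ consider, for $U,V\in C^2(\mathbb R)$, the advance-delay system (the case $a=0$, $\beta=-1$) $$U''(z)+U(z)-U(z)^3=\varepsilon\big(-\lambda_M'V''(z-p)-\lambda_MV''(z)-\lambda_E'V(z-p)-\lambda_EV(z)-\gamma U'(z)+\sin\Omega z\big),$$ $$V''(z)+V(z)-V(z)^3=\varepsilon\big(-\lambda_MU''(z)-\lambda_M'U''(z+p)-\lambda_EU(z)-\lambda_E'U(z+p)+\gamma V'(z)+\sin\Omega z\big),\qquad(1_\varepsilon)$$ and write $\Phi_{U,V}=(U',U,V',V)$. For $\varepsilon=0$ and all $\tau_1,\tau_2\in\mathbb R$, the pair $U(z)=\tanh\frac{z-\tau_1}{\sqrt2}$, $V(z)=\tanh\frac{z-\tau_2}{\sqrt2}$ solves $(1_0)$ and is heteroclinic from $(0,-1,0,-1)$ to $(0,1,0,1)$. Suppose that, for at least one choice of the sign $\pm$, $$0<\Big|\pm(\lambda_E+\lambda_E')-\frac{\sqrt2\,\gamma}{3}\Big|<\frac{\Omega\pi}{\sqrt2}\,\operatorname{csch}\frac{\Omega\pi}{\sqrt2}.$$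 Then a heteroclinic solution persists for all small $\varepsilon\neq0$: there are $\tau_1,\tau_2\in\mathbb R$ such that for every $\delta>0$ there is $\varepsilon_0>0$ such that for every $\varepsilon$ with $0<|\varepsilon|<\varepsilon_0$ the system $(1_\varepsilon)$ has a solution $(U,V)\in C^2(\mathbb R)^2$ and two $\frac{2\pi}{\Omega}$-periodic solutions $(P_\pm,Q_\pm)\in C^2(\mathbb R)^2$ with the following properties: $\Phi_{P_\pm,Q_\pm}(z)$ is within $\delta$ of $(0,\pm1,0,\pm1)$ for all $z\in\mathbb R$; $\Phi_{U,V}(z)-\Phi_{P_\pm,Q_\pm}(z)\to0$ as $z\to\pm\infty$; and, for all $z\in\mathbb R$, $\Phi_{U,V}(z)$ is within $\delta$ of $\Phi_{U_0,V_0}(z)$, where $U_0(z)=\tanh\frac{z-\tau_1}{\sqrt2}$ and $V_0(z)=\tanh\frac{z-\tau_2}{\sqrt2}$ (distances in $\mathbb R^4$ in the maximum norm). -/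

import Mathlib

open Filter Topology

/-- `(U, V)` is a classical (twice continuously differentiable) solution on the whole line of the
travelling-wave system of advance-delay equations with parameters
`a, β, λ_M, λ_M', λ_E, λ_E', γ, Ω, p, ε`. -/
def IsWaveSolution (a β lamM lamM' lamE lamE' γ Ω p ε : ℝ) (U V : ℝ → ℝ) : Prop :=
  ContDiff ℝ 2 U ∧ ContDiff ℝ 2 V ∧
  (∀ z : ℝ, deriv (deriv U) z + U z + a * U z ^ 2 + β * U z ^ 3 =
    ε * (-lamM' * deriv (deriv V) (z - p) - lamM * deriv (deriv V) z
      - lamE' * V (z - p) - lamE * V z - γ * deriv U z + Real.sin (Ω * z))) ∧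
  (∀ z : ℝ, deriv (deriv V) z + V z + a * V z ^ 2 + β * V z ^ 3 =
    ε * (-lamM * deriv (deriv U) z - lamM' * deriv (deriv U) (z + p)
      - lamE * U z - lamE' * U (z + p) + γ * deriv V z + Real.sin (Ω * z)))

/-- The phase point `(U', U, V', V)` at `z`, in `ℝ⁴` with the maximum metric. -/
noncomputable def phase (U V : ℝ → ℝ) (z : ℝ) : ℝ × ℝ × ℝ × ℝ :=
  (deriv U z, U z, deriv V z, V z)

/-- The kink `tanh (z / √2)` translated by `τ`. -/
noncomputable def kink (τ : ℝ) (z : ℝ) : ℝ := Real.tanh ((z - τ) / √2)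

/-- A solution of the wave system that has the period of the forcing term. -/
def IsPeriodicWave (a β lamM lamM' lamE lamE' γ Ω p ε : ℝ) (P Q : ℝ → ℝ) : Prop :=
  IsWaveSolution a β lamM lamM' lamE lamE' γ Ω p ε P Q ∧
  Function.Periodic P (2 * Real.pi / Ω) ∧ Function.Periodic Q (2 * Real.pi / Ω)

/-- `(U, V)` is a solution of the wave system which is asymptotic, in phase space, to the
periodic solution `(Pm, Qm)` as `z → -∞` and to the periodic solution `(Pp, Qp)` as `z → +∞`. -/
def IsHeteroclinicWave (a β lamM lamM' lamE lamE' γ Ω p ε : ℝ)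
    (Pm Qm Pp Qp U V : ℝ → ℝ) : Prop :=
  IsPeriodicWave a β lamM lamM' lamE lamE' γ Ω p ε Pm Qm ∧
  IsPeriodicWave a β lamM lamM' lamE lamE' γ Ω p ε Pp Qp ∧
  IsWaveSolution a β lamM lamM' lamE lamE' γ Ω p ε U V ∧
  Tendsto (fun z => dist (phase U V z) (phase Pm Qm z)) atBot (𝓝 0) ∧
  Tendsto (fun z => dist (phase U V z) (phase Pp Qp z)) atTop (𝓝 0)

/-! The system is invariant under `(U, V)(z) ↦ (-V(-z), -U(-z))`, so it suffices to find solutions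
with `V(z) = -U(-z)`. This leaves one scalar equation for `U`, in which the coupling is evaluated at
reflected points. A kink for `U` centred at `τ` forces the kink for `V` to be centred at `-τ`.

Write `U(z) = profile x + ε w x` with `x = z - τ`. The linearisation `w'' + (1 - 3 profile²) w` has
kernel spanned by `bell` and factors as `(D - √2 profile)(D + √2 profile)`. Solving two first-order
equations gives a bounded inverse on bounded functions orthogonal to `bell` (`unstableOp`,
`stableOp`, `corrOp`), so no Fredholm theory for advance-delay operators is needed. The
Lyapunov–Schmidt argument (`exists_solution_of_nondegenerate`, `exists_corrected_kink`) then
requires a zero `τ` of the Melnikov function `M(τ)`, the `bell`-average of the leading-order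
right-hand side, at which `M'(τ) ≠ 0`.

The forcing contributes `β sin(Ωτ)` to `M`, where `β = bellFourier Ω` is computed from a Beta
integral. For `τ → ±∞` the reflected kink looks constant where `bell` lives, so the rest of `M`
tends to `∓(λ_E + λ_E') - √2γ/3`. If this limit is smaller than `β` in absolute value, the
intermediate value theorem gives simple zeros far out (`exists_simple_melnikov_zero`).

It remains to find the periodic waves. Near `U = V = 1` the differences between a solution and its
translates by multiples of the forcing period satisfy `w'' = 2w` up to a small defect. Hyperbolicity
makes these differences tend to zero uniformly (`jetBound_arbitrarily_small`), so the translates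
converge to a periodic solution at `+∞` (`asymptoticallyPeriodic_of_isHalfWave`). Reversibility
supplies the one at `-∞` (`exists_periodic_of_reversible`). -/

section

open MeasureTheory BoundedContinuousFunction

/-! ### The kink, its derivative, and their limits and integrals. -/

/-- The kink `tanh (x / √2)` centred at the origin. -/
noncomputable def profile (x : ℝ) : ℝ := Real.tanh (x / √2)

/-- The derivative of `profile`. -/
noncomputable def bell (x : ℝ) : ℝ := (1 - profile x ^ 2) / √2

lemma sqrt_two_mul_self : √2 * √2 = (2 : ℝ) := Real.mul_self_sqrt (by norm_num)

lemma sqrt_two_pos : (0 : ℝ) < √2 := by positivity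

lemma kink_eq_profile (τ z : ℝ) : kink τ z = profile (z - τ) := rfl

lemma profile_lt_one (x : ℝ) : profile x < 1 := Real.tanh_lt_one _

lemma neg_one_lt_profile (x : ℝ) : -1 < profile x := Real.neg_one_lt_tanh _

lemma abs_profile_le (x : ℝ) : |profile x| ≤ 1 :=
  abs_le.2 ⟨(neg_one_lt_profile x).le, (profile_lt_one x).le⟩

lemma profile_neg (x : ℝ) : profile (-x) = -profile x := by
  simp [profile, neg_div, Real.tanh_neg]

lemma bell_neg (x : ℝ) : bell (-x) = bell x := by simp [bell, profile_neg]

lemma bell_pos (x : ℝ) : 0 < bell x := by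
  have h1 := profile_lt_one x
  have h2 := neg_one_lt_profile x
  exact div_pos (by nlinarith) sqrt_two_pos

lemma bell_le_one (x : ℝ) : bell x ≤ 1 := by
  rw [bell, div_le_one sqrt_two_pos]
  have : (1 : ℝ) ≤ √2 := Real.one_le_sqrt.2 (by norm_num)
  nlinarith [sq_nonneg (profile x)]

lemma abs_bell_le (x : ℝ) : |bell x| ≤ 1 := by
  rw [abs_of_pos (bell_pos x)]; exact bell_le_one x

lemma sqrt_two_mul_bell (x : ℝ) : √2 * bell x = 1 - profile x ^ 2 := by
  rw [bell]; field_simp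

lemma bell_eq_inv_cosh (x : ℝ) : bell x = (√2 * Real.cosh (x / √2) ^ 2)⁻¹ := by
  have h := Real.cosh_sq (x / √2)
  have h0 := Real.cosh_pos (x / √2)
  rw [bell, profile, Real.tanh_eq_sinh_div_cosh]
  field_simp
  rw [h]; ring

lemma hasDerivAt_profile (x : ℝ) : HasDerivAt profile (bell x) x := by
  have h0 := (Real.cosh_pos (x / √2)).ne'
  have hd : HasDerivAt (fun x : ℝ => x / √2) (1 / √2) x := (hasDerivAt_id x).div_const _
  have h := (hd.sinh).div (hd.cosh) h0
  have e : profile = fun x => Real.sinh (x / √2) / Real.cosh (x / √2) := by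
    funext y; rw [profile, Real.tanh_eq_sinh_div_cosh]
  rw [e]
  refine h.congr_deriv ?_
  have hc := Real.cosh_sq (x / √2)
  rw [bell_eq_inv_cosh]
  field_simp
  rw [hc]; ring

lemma hasDerivAt_bell (x : ℝ) : HasDerivAt bell (-(√2 * profile x * bell x)) x := by
  have h := (((hasDerivAt_profile x).pow 2).const_sub 1).div_const √2
  refine h.congr_deriv ?_
  have := sqrt_two_mul_self
  field_simp
  simp
  nlinarith

lemma continuous_profile : Continuous profile :=
  continuous_iff_continuousAt.2 fun x => (hasDerivAt_profile x).continuousAt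

lemma continuous_bell : Continuous bell :=
  continuous_iff_continuousAt.2 fun x => (hasDerivAt_bell x).continuousAt

lemma tendsto_profile_atTop : Tendsto profile atTop (𝓝 1) := by
  have h2 : Tendsto (fun x : ℝ => Real.exp (-(√2 * x))) atTop (𝓝 0) :=
    Real.tendsto_exp_neg_atTop_nhds_zero.comp (tendsto_id.const_mul_atTop sqrt_two_pos)
  have h3 : Tendsto (fun x : ℝ => (1 - Real.exp (-(√2 * x))) / (1 + Real.exp (-(√2 * x)))) atTop
      (𝓝 ((1 - 0) / (1 + 0))) := (h2.const_sub 1).div (h2.const_add 1) (by norm_num)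
  simp only [sub_zero, add_zero, div_one] at h3
  refine h3.congr fun x => ?_
  have e : √2 * x = x / √2 + x / √2 := by
    field_simp; rw [Real.sq_sqrt (by norm_num)]; ring
  rw [profile, Real.tanh_eq, e, neg_add, Real.exp_add]
  have h4 : Real.exp (x / √2) * Real.exp (-(x / √2)) = 1 := by rw [← Real.exp_add]; simp
  have h5 := Real.exp_pos (x / √2)
  have h6 := Real.exp_pos (-(x / √2))
  rw [div_eq_div_iff (by positivity) (by positivity)]
  linear_combination (-2 * Real.exp (-(x / √2))) * h4

lemma tendsto_profile_atBot : Tendsto profile atBot (𝓝 (-1)) := by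
  have h := (tendsto_profile_atTop.comp tendsto_neg_atBot_atTop).neg
  refine h.congr fun x => ?_
  simp [profile_neg]

lemma tendsto_bell_atTop : Tendsto bell atTop (𝓝 0) := by
  have h := ((tendsto_profile_atTop.pow 2).const_sub 1).div_const √2
  rw [one_pow, sub_self, zero_div] at h
  exact h

lemma tendsto_bell_atBot : Tendsto bell atBot (𝓝 0) := by
  have h := ((tendsto_profile_atBot.pow 2).const_sub 1).div_const √2
  rw [neg_one_sq, sub_self, zero_div] at h
  exact h


lemma integrable_bell : Integrable bell := by
  rw [← integrableOn_univ, ← Set.Iic_union_Ioi (a := (0 : ℝ))]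
  refine IntegrableOn.union ?_ ?_
  · have h : IntegrableOn bell (Set.Ioi 0) := integrableOn_Ioi_deriv_of_nonneg'
      (fun x _ => hasDerivAt_profile x) (fun x _ => (bell_pos x).le) tendsto_profile_atTop
    have h2 := (integrableOn_Ici_iff_integrableOn_Ioi).2 h
    have h3 := h2.comp_neg
    simp only [bell_neg] at h3
    simpa using h3
  · exact integrableOn_Ioi_deriv_of_nonneg'
      (fun x _ => hasDerivAt_profile x) (fun x _ => (bell_pos x).le) tendsto_profile_atTop

lemma integral_bell : ∫ x, bell x = 2 := by
  rw [integral_of_hasDerivAt_of_tendsto hasDerivAt_profile integrable_bell tendsto_profile_atBot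
    tendsto_profile_atTop]
  norm_num

lemma integral_Iic_bell (x : ℝ) : ∫ t in Set.Iic x, bell t = 1 + profile x := by
  rw [integral_Iic_of_hasDerivAt_of_tendsto' (fun x _ => hasDerivAt_profile x)
    integrable_bell.integrableOn tendsto_profile_atBot]
  ring

lemma integral_Ioi_bell (x : ℝ) : ∫ t in Set.Ioi x, bell t = 1 - profile x :=
  integral_Ioi_of_hasDerivAt_of_tendsto' (fun x _ => hasDerivAt_profile x)
    integrable_bell.integrableOn tendsto_profile_atTop

lemma integral_bell_sq : ∫ x, bell x * bell x = 2 * √2 / 3 := by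
  have hd : ∀ x, HasDerivAt (fun x => (profile x - profile x ^ 3 / 3) / √2) (bell x * bell x) x := by
    intro x
    have h := ((hasDerivAt_profile x).sub (((hasDerivAt_profile x).pow 3).div_const 3)).div_const √2
    refine h.congr_deriv ?_
    have := sqrt_two_mul_bell x
    field_simp
    simp
    rw [← sub_eq_zero]
    linear_combination (-3 * bell x) * this
  have hi : Integrable fun x => bell x * bell x :=
    integrable_bell.bdd_mul (c := 1) continuous_bell.aestronglyMeasurable
      (Eventually.of_forall fun x => by simpa using abs_bell_le x)
  have ht := (tendsto_profile_atTop.sub ((tendsto_profile_atTop.pow 3).div_const 3)).div_const √2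
  have hb := (tendsto_profile_atBot.sub ((tendsto_profile_atBot.pow 3).div_const 3)).div_const √2
  rw [integral_of_hasDerivAt_of_tendsto hd hi hb ht]
  have := sqrt_two_mul_self
  field_simp
  nlinarith

/-! ### Bounded inversion of the two first-order factors of the linearisation. -/

lemma integrable_bell_mul (f : ℝ →ᵇ ℝ) : Integrable fun x => bell x * f x := by
  simp_rw [fun x => mul_comm (bell x) (f x)]
  exact integrable_bell.bdd_mul (c := ‖f‖) f.continuous.aestronglyMeasurable
    (Eventually.of_forall f.norm_coe_le_norm)

/-- The average of a bounded continuous function against the probability density `bell / 2`. -/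
noncomputable def bellMean : (ℝ →ᵇ ℝ) →L[ℝ] ℝ :=
  LinearMap.mkContinuous
    { toFun := fun f => (∫ x, bell x * f x) / 2
      map_add' := fun f g => by
        simp only [BoundedContinuousFunction.add_apply, mul_add]
        rw [integral_add (integrable_bell_mul f) (integrable_bell_mul g)]; ring
      map_smul' := fun c f => by
        simp only [BoundedContinuousFunction.coe_smul, smul_eq_mul, RingHom.id_apply]
        simp_rw [mul_left_comm _ c, integral_const_mul]; ring } 1 fun f => by
    have h : ‖∫ x, bell x * f x‖ ≤ ∫ x, bell x * ‖f‖ := by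
      refine norm_integral_le_of_norm_le (integrable_bell.mul_const _) (Eventually.of_forall fun x => ?_)
      rw [norm_mul, Real.norm_of_nonneg (bell_pos x).le]
      exact mul_le_mul_of_nonneg_left (f.norm_coe_le_norm x) (bell_pos x).le
    rw [integral_mul_const, integral_bell] at h
    simp only [LinearMap.coe_mk, AddHom.coe_mk, norm_div, one_mul]
    rw [div_le_iff₀ (by norm_num)]
    simpa [mul_comm] using h

lemma bellMean_apply (f : ℝ →ᵇ ℝ) : bellMean f = (∫ x, bell x * f x) / 2 := rfl

/-- The projection of bounded continuous functions onto those of `bellMean` zero. -/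
noncomputable def meanFree : (ℝ →ᵇ ℝ) →L[ℝ] (ℝ →ᵇ ℝ) :=
  ContinuousLinearMap.id ℝ _ - bellMean.smulRight (BoundedContinuousFunction.const ℝ (1 : ℝ))

lemma meanFree_apply (f : ℝ →ᵇ ℝ) (x : ℝ) : meanFree f x = f x - bellMean f := by
  simp [meanFree]

lemma integral_bell_mul_meanFree (f : ℝ →ᵇ ℝ) : ∫ x, bell x * meanFree f x = 0 := by
  simp only [meanFree_apply, mul_sub]
  rw [integral_sub (integrable_bell_mul f) (integrable_bell.mul_const _), integral_mul_const,
    integral_bell, bellMean_apply]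
  ring

lemma abs_setIntegral_bell_mul_le (f : ℝ →ᵇ ℝ) (s : Set ℝ) :
    |∫ t in s, bell t * f t| ≤ ‖f‖ * ∫ t in s, bell t := by
  rw [← integral_const_mul, ← Real.norm_eq_abs]
  refine norm_integral_le_of_norm_le (integrable_bell.integrableOn.const_mul _)
    (Eventually.of_forall fun x => ?_)
  rw [norm_mul, Real.norm_of_nonneg (bell_pos x).le, mul_comm]
  exact mul_le_mul_of_nonneg_right (f.norm_coe_le_norm x) (bell_pos x).le

lemma hasDerivAt_integral_Iic_bell_mul (f : ℝ →ᵇ ℝ) (x : ℝ) :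
    HasDerivAt (fun x => ∫ t in Set.Iic x, bell t * f t) (bell x * f x) x := by
  have hc : Continuous fun t => bell t * f t := continuous_bell.mul f.continuous
  have h : HasDerivAt (fun x => (∫ t in Set.Iic 0, bell t * f t) + ∫ t in (0 : ℝ)..x, bell t * f t)
      (bell x * f x) x :=
    (intervalIntegral.integral_hasDerivAt_right (hc.intervalIntegrable _ _)
      (hc.stronglyMeasurableAtFilter _ _) hc.continuousAt).const_add _
  refine h.congr_of_eventuallyEq (Eventually.of_forall fun y => ?_)
  simp only
  rw [← intervalIntegral.integral_Iic_sub_Iic (integrable_bell_mul f).integrableOn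
    (integrable_bell_mul f).integrableOn]
  ring

/-- The bounded solution of `r' = √2 * profile * r + meanFree f`. -/
noncomputable def unstableFun (f : ℝ →ᵇ ℝ) (x : ℝ) : ℝ :=
  (bell x)⁻¹ * ∫ t in Set.Iic x, bell t * meanFree f t

lemma hasDerivAt_unstableFun (f : ℝ →ᵇ ℝ) (x : ℝ) :
    HasDerivAt (unstableFun f) (√2 * profile x * unstableFun f x + meanFree f x) x := by
  have h := ((hasDerivAt_bell x).inv (bell_pos x).ne').mul
    (hasDerivAt_integral_Iic_bell_mul (meanFree f) x)
  refine h.congr_deriv ?_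
  have := (bell_pos x).ne'
  simp only [unstableFun, Pi.inv_apply]
  field_simp

/-- The homogeneous solution `1 / bell` blows up at both ends. Since `meanFree f` is orthogonal to
`bell`, the integral over `(-∞, x]` is minus that over `(x, ∞)`, so it is at most `‖meanFree f‖`
times the smaller of `1 ± profile x`. This compensates `1 / bell`, because `√2 bell = (1 -
profile)(1 + profile)`. -/
lemma abs_unstableFun_le (f : ℝ →ᵇ ℝ) (x : ℝ) : |unstableFun f x| ≤ √2 * ‖meanFree f‖ := by
  have hb := bell_pos x
  have h1 := abs_setIntegral_bell_mul_le (meanFree f) (Set.Iic x)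
  have h2 := abs_setIntegral_bell_mul_le (meanFree f) (Set.Ioi x)
  have h3 : (∫ t in Set.Iic x, bell t * meanFree f t) + ∫ t in Set.Ioi x, bell t * meanFree f t = 0 := by
    rw [intervalIntegral.integral_Iic_add_Ioi (integrable_bell_mul _).integrableOn
      (integrable_bell_mul _).integrableOn, integral_bell_mul_meanFree]
  rw [eq_neg_of_add_eq_zero_right h3, abs_neg, integral_Ioi_bell] at h2
  rw [integral_Iic_bell] at h1
  rw [unstableFun, abs_mul, abs_of_pos (inv_pos.2 hb), inv_mul_le_iff₀ hb]
  have hs := sqrt_two_mul_bell x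
  have hn := norm_nonneg (meanFree f)
  have e : bell x * (√2 * ‖meanFree f‖) = ‖meanFree f‖ * ((1 + profile x) * (1 - profile x)) := by
    linear_combination ‖meanFree f‖ * hs
  rw [e]
  have p1 := profile_lt_one x
  have p2 := neg_one_lt_profile x
  rcases le_total 0 (profile x) with h | h
  · refine h2.trans (mul_le_mul_of_nonneg_left ?_ hn)
    nlinarith
  · refine h1.trans (mul_le_mul_of_nonneg_left ?_ hn)
    nlinarith

lemma continuous_unstableFun (f : ℝ →ᵇ ℝ) : Continuous (unstableFun f) :=
  continuous_iff_continuousAt.2 fun x => (hasDerivAt_unstableFun f x).continuousAt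

/-- `unstableFun` as a bounded operator. -/
noncomputable def unstableOp : (ℝ →ᵇ ℝ) →L[ℝ] (ℝ →ᵇ ℝ) :=
  LinearMap.mkContinuous
    { toFun := fun f => BoundedContinuousFunction.ofNormedAddCommGroup (unstableFun f)
        (continuous_unstableFun f) _ (abs_unstableFun_le f)
      map_add' := fun f g => by
        ext x
        simp only [coe_ofNormedAddCommGroup, BoundedContinuousFunction.add_apply, unstableFun,
          map_add, mul_add]
        rw [integral_add (integrable_bell_mul _).integrableOn (integrable_bell_mul _).integrableOn]
        ring
      map_smul' := fun c f => by
        ext x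
        simp only [coe_ofNormedAddCommGroup, BoundedContinuousFunction.coe_smul, unstableFun,
          map_smul, smul_eq_mul, RingHom.id_apply]
        simp_rw [mul_left_comm _ c, integral_const_mul]; ring } (√2 * ‖meanFree‖) fun f => by
    refine (BoundedContinuousFunction.norm_le (by positivity)).2 fun x => ?_
    refine (abs_unstableFun_le f x).trans ?_
    rw [mul_assoc]
    exact mul_le_mul_of_nonneg_left (meanFree.le_opNorm f) sqrt_two_pos.le

lemma hasDerivAt_unstableOp (f : ℝ →ᵇ ℝ) (x : ℝ) :
    HasDerivAt (unstableOp f) (√2 * profile x * unstableOp f x + meanFree f x) x :=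
  hasDerivAt_unstableFun f x

/-- The solution of `y' = -√2 * profile * y + f` with `y 0 = 0`. -/
noncomputable def stableFun (f : ℝ →ᵇ ℝ) (x : ℝ) : ℝ :=
  bell x * ∫ t in (0 : ℝ)..x, (bell t)⁻¹ * f t

lemma continuous_inv_bell_mul (f : ℝ →ᵇ ℝ) : Continuous fun t => (bell t)⁻¹ * f t :=
  (continuous_bell.inv₀ fun x => (bell_pos x).ne').mul f.continuous

lemma hasDerivAt_stableFun (f : ℝ →ᵇ ℝ) (x : ℝ) :
    HasDerivAt (stableFun f) (-(√2 * profile x * stableFun f x) + f x) x := by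
  have hc := continuous_inv_bell_mul f
  have h := (hasDerivAt_bell x).mul (intervalIntegral.integral_hasDerivAt_right
    (hc.intervalIntegrable 0 x) (hc.stronglyMeasurableAtFilter _ _) hc.continuousAt)
  refine h.congr_deriv ?_
  have := (bell_pos x).ne'
  simp only [stableFun]
  field_simp

lemma inv_bell_eq (x : ℝ) : (bell x)⁻¹ = (Real.cosh (√2 * x) + 1) / √2 := by
  have e : √2 * x = 2 * (x / √2) := by
    field_simp; rw [Real.sq_sqrt (by norm_num)]; ring
  rw [bell_eq_inv_cosh, inv_inv, e, Real.cosh_two_mul]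
  have h := Real.cosh_sq (x / √2)
  field_simp
  rw [Real.sq_sqrt (by norm_num)]
  linarith

/-- `1 / bell` is dominated by `√2 cosh(√2 t)`, the derivative of `sinh(√2 t)`. -/
lemma abs_integral_inv_bell_mul_le (f : ℝ →ᵇ ℝ) (x : ℝ) :
    |∫ t in (0 : ℝ)..x, (bell t)⁻¹ * f t| ≤ ‖f‖ * |Real.sinh (√2 * x)| := by
  have hd : ∀ t, HasDerivAt (fun t => Real.sinh (√2 * t)) (Real.cosh (√2 * t) * √2) t := fun t =>
    ((hasDerivAt_id t).const_mul √2).sinh.congr_deriv (by simp)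
  have hc : Continuous fun t => Real.cosh (√2 * t) * √2 := by fun_prop
  have hi := intervalIntegral.integral_eq_sub_of_hasDerivAt (a := 0) (b := x) (fun t _ => hd t)
    (hc.intervalIntegrable _ _)
  simp only [mul_zero, Real.sinh_zero, sub_zero] at hi
  have h := intervalIntegral.norm_integral_le_abs_of_norm_le (a := 0) (b := x) (μ := volume)
    (f := fun t => (bell t)⁻¹ * f t) (g := fun t => ‖f‖ * (Real.cosh (√2 * t) * √2))
    (Eventually.of_forall fun t => ?_) ((hc.const_mul _).intervalIntegrable _ _)
  · rwa [intervalIntegral.integral_const_mul, hi, abs_mul, abs_norm] at h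
  · have h1 : (bell t)⁻¹ ≤ Real.cosh (√2 * t) * √2 := by
      rw [inv_bell_eq, div_le_iff₀ sqrt_two_pos, mul_assoc, sqrt_two_mul_self]
      linarith [Real.one_le_cosh (√2 * t)]
    rw [norm_mul, Real.norm_of_nonneg (inv_pos.2 (bell_pos t)).le, mul_comm]
    exact mul_le_mul (f.norm_coe_le_norm t) h1 (inv_pos.2 (bell_pos t)).le (norm_nonneg _)

/-- The homogeneous solution `bell` decays at both ends at the rate at which the integral of `1 /
bell` grows, so no solvability condition arises for this factor. -/
lemma abs_stableFun_le (f : ℝ →ᵇ ℝ) (x : ℝ) : |stableFun f x| ≤ √2 * ‖f‖ := by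
  have hb := bell_pos x
  rw [stableFun, abs_mul, abs_of_pos hb]
  have h := abs_integral_inv_bell_mul_le f x
  have h2 : |Real.sinh (√2 * x)| ≤ √2 * (bell x)⁻¹ := by
    rw [inv_bell_eq, mul_div_cancel₀ _ sqrt_two_pos.ne', abs_le]
    have h1 := Real.sinh_lt_cosh (√2 * x)
    have h3 := Real.cosh_add_sinh (√2 * x)
    have h4 := Real.exp_pos (√2 * x)
    constructor <;> linarith
  calc bell x * |∫ t in (0 : ℝ)..x, (bell t)⁻¹ * f t|
      ≤ bell x * (‖f‖ * (√2 * (bell x)⁻¹)) := mul_le_mul_of_nonneg_left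
        (h.trans (mul_le_mul_of_nonneg_left h2 (norm_nonneg _))) hb.le
    _ = √2 * ‖f‖ := by field_simp

lemma continuous_stableFun (f : ℝ →ᵇ ℝ) : Continuous (stableFun f) :=
  continuous_iff_continuousAt.2 fun x => (hasDerivAt_stableFun f x).continuousAt

/-- `stableFun` as a bounded operator. -/
noncomputable def stableOp : (ℝ →ᵇ ℝ) →L[ℝ] (ℝ →ᵇ ℝ) :=
  LinearMap.mkContinuous
    { toFun := fun f => BoundedContinuousFunction.ofNormedAddCommGroup (stableFun f)
        (continuous_stableFun f) _ (abs_stableFun_le f)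
      map_add' := fun f g => by
        ext x
        simp only [coe_ofNormedAddCommGroup, BoundedContinuousFunction.add_apply, stableFun, mul_add]
        rw [intervalIntegral.integral_add ((continuous_inv_bell_mul f).intervalIntegrable _ _)
          ((continuous_inv_bell_mul g).intervalIntegrable _ _)]
        ring
      map_smul' := fun c f => by
        ext x
        simp only [coe_ofNormedAddCommGroup, BoundedContinuousFunction.coe_smul, stableFun,
          smul_eq_mul, RingHom.id_apply]
        simp_rw [mul_left_comm _ c, intervalIntegral.integral_const_mul]; ring } √2 fun f =>
    (BoundedContinuousFunction.norm_le (by positivity)).2 (abs_stableFun_le f)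

lemma hasDerivAt_stableOp (f : ℝ →ᵇ ℝ) (x : ℝ) :
    HasDerivAt (stableOp f) (-(√2 * profile x * stableOp f x) + f x) x :=
  hasDerivAt_stableFun f x

/-! ### Reflections and the abstract Lyapunov–Schmidt step. -/

/-- Composition with the reflection `x ↦ q - x`. -/
noncomputable def reflectOp (q : ℝ) : (ℝ →ᵇ ℝ) →L[ℝ] (ℝ →ᵇ ℝ) :=
  LinearMap.mkContinuous
    { toFun := fun f => f.compContinuous ⟨fun x => q - x, by fun_prop⟩
      map_add' := fun f g => by ext x; simp
      map_smul' := fun c f => by ext x; simp } 1 fun f => by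
    rw [one_mul]
    exact (BoundedContinuousFunction.norm_le (norm_nonneg _)).2 fun x => f.norm_coe_le_norm _

@[simp] lemma reflectOp_apply (q : ℝ) (f : ℝ →ᵇ ℝ) (x : ℝ) : reflectOp q f x = f (q - x) := rfl

/-- `profile` as a bounded continuous function. -/
noncomputable def profileB : ℝ →ᵇ ℝ :=
  BoundedContinuousFunction.ofNormedAddCommGroup profile continuous_profile 1 abs_profile_le

/-- `bell` as a bounded continuous function. -/
noncomputable def bellB : ℝ →ᵇ ℝ :=
  BoundedContinuousFunction.ofNormedAddCommGroup bell continuous_bell 1 abs_bell_le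

@[simp] lemma profileB_apply (x : ℝ) : profileB x = profile x := rfl

@[simp] lemma bellB_apply (x : ℝ) : bellB x = bell x := rfl

/-- Lyapunov–Schmidt reduction: if the bifurcation function, which is affine to leading order in
the kernel coordinate `c`, has a nondegenerate zero, then the reduced problem is solvable for all
small `ε`, with bounded solutions. -/
lemma exists_solution_of_nondegenerate {X : Type*} [NormedCommRing X] [NormedAlgebra ℝ X]
    [CompleteSpace X] (S N : X × ℝ →L[ℝ] X) (m : X →L[ℝ] ℝ) (k g : X) (c₀ : ℝ)
    (h0 : m (N (g, c₀) + k * (S (g, c₀) * S (g, c₀))) = 0)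
    (hJ : m (N (0, 1) + (2 : ℝ) • (k * (S (g, c₀) * S (0, 1)))) ≠ 0) :
    ∃ R ε₀ : ℝ, 0 < R ∧ 0 < ε₀ ∧ ∀ ε : ℝ, |ε| < ε₀ → ∃ y : X × ℝ, ‖y‖ ≤ R ∧
      y.1 = g + ε • (N y + k * (S y * S y) + ε • (S y * (S y * S y))) ∧
      m (N y + k * (S y * S y) + ε • (S y * (S y * S y))) = 0 := by
  -- The parameter `ε` is carried along as the first coordinate of `F`. Solvability for all small
  -- `ε` then follows from local surjectivity of `F` at `(0, (g, c₀))`; neither uniqueness nor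
  -- continuity in `ε` is needed.
  set W : ℝ × (X × ℝ) → X := fun e =>
    N e.2 + k * (S e.2 * S e.2) + e.1 • (S e.2 * (S e.2 * S e.2)) with hW
  set F : ℝ × (X × ℝ) → ℝ × (X × ℝ) := fun e => (e.1, (e.2.1 - g - e.1 • W e, m (W e))) with hF
  set a : ℝ × (X × ℝ) := (0, (g, c₀)) with ha
  set s := S (g, c₀) with hs
  have hfst : HasStrictFDerivAt (fun e : ℝ × (X × ℝ) => e.1)
      (ContinuousLinearMap.fst ℝ ℝ (X × ℝ)) a := hasStrictFDerivAt_fst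
  have hsnd : HasStrictFDerivAt (fun e : ℝ × (X × ℝ) => e.2)
      (ContinuousLinearMap.snd ℝ ℝ (X × ℝ)) a := hasStrictFDerivAt_snd
  have hS : HasStrictFDerivAt (fun e : ℝ × (X × ℝ) => S e.2)
      (S ∘L ContinuousLinearMap.snd ℝ ℝ (X × ℝ)) a := S.hasStrictFDerivAt.comp a hsnd
  have hN : HasStrictFDerivAt (fun e : ℝ × (X × ℝ) => N e.2)
      (N ∘L ContinuousLinearMap.snd ℝ ℝ (X × ℝ)) a := N.hasStrictFDerivAt.comp a hsnd
  obtain ⟨W', hW', hW'v⟩ : ∃ W' : ℝ × (X × ℝ) →L[ℝ] X, HasStrictFDerivAt W W' a ∧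
      ∀ v, W' v = N v.2 + (2 : ℝ) • (k * (s * S v.2)) + v.1 • (s * (s * s)) := by
    refine ⟨_, (hN.add ((hS.mul hS).const_mul k)).add (hfst.smul (hS.mul (hS.mul hS))), fun v => ?_⟩
    simp [ha, ← hs]
    rw [two_smul]
  have hfst2 : HasStrictFDerivAt (fun e : ℝ × (X × ℝ) => e.2.1)
      (ContinuousLinearMap.fst ℝ X ℝ ∘L ContinuousLinearMap.snd ℝ ℝ (X × ℝ)) a :=
    (ContinuousLinearMap.fst ℝ X ℝ).hasStrictFDerivAt.comp a hsnd
  have hF1 := hfst.prodMk (((hfst2.sub_const g).sub (hfst.smul hW')).prodMk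
    (m.hasStrictFDerivAt.comp a hW'))
  have hFa : F a = 0 := by
    simpa [hF, hW, ha, ← hs] using h0
  -- Since `a.1 = 0`, the derivative is triangular: `ε` is read off, then the `X`-component, and the
  -- kernel coordinate is obtained by dividing by the nonzero number `J`.
  have hsurj : LinearMap.range ((ContinuousLinearMap.fst ℝ ℝ (X × ℝ)).prod
      (((ContinuousLinearMap.fst ℝ X ℝ ∘L ContinuousLinearMap.snd ℝ ℝ (X × ℝ)) -
        (a.1 • W' + (ContinuousLinearMap.fst ℝ ℝ (X × ℝ)).smulRight (W a))).prod (m ∘L W'))).toLinearMap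
        = ⊤ := by
    rw [LinearMap.range_eq_top]
    rintro ⟨x, b, d⟩
    set J := m (N (0, 1) + (2 : ℝ) • (k * (s * S (0, 1)))) with hJd
    set b' := b + x • W a with hb'
    set d' := m (N (b', 0) + (2 : ℝ) • (k * (s * S (b', 0))) + x • (s * (s * s))) with hd'
    refine ⟨(x, (b', (d - d') / J)), ?_⟩
    have e : ((b', (d - d') / J) : X × ℝ) = (b', 0) + ((d - d') / J) • (0, 1) := by simp
    have e2 : m (W' (x, (b', (d - d') / J))) = d := by
      rw [hW'v]
      simp only
      rw [e, N.map_add, S.map_add, N.map_smul, S.map_smul]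
      have : N (b', 0) + ((d - d') / J) • N (0, 1) + (2 : ℝ) • (k * (s * (S (b', 0) + ((d - d') / J) •
          S (0, 1)))) + x • (s * (s * s)) = (N (b', 0) + (2 : ℝ) • (k * (s * S (b', 0))) + x • (s * (s * s)))
          + ((d - d') / J) • (N (0, 1) + (2 : ℝ) • (k * (s * S (0, 1)))) := by
        simp only [mul_add, smul_add, mul_smul_comm, smul_comm (2 : ℝ)]
        abel
      rw [this, map_add, map_smul, ← hd', ← hJd, smul_eq_mul, div_mul_cancel₀ _ hJ]
      ring
    ext1
    · simp
    ext1
    · simp [ha, hb']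
    · simpa using e2
  have hmap := hF1.map_nhds_eq_of_surj hsurj
  change map F (𝓝 a) = 𝓝 (F a) at hmap
  rw [hFa] at hmap
  have hball : F '' Metric.ball a 1 ∈ 𝓝 (0 : ℝ × (X × ℝ)) := by
    rw [← hmap]; exact image_mem_map (Metric.ball_mem_nhds a one_pos)
  have hcont : Tendsto (fun ε : ℝ => ((ε, (0, 0)) : ℝ × (X × ℝ))) (𝓝 0) (𝓝 0) :=
    (by fun_prop : Continuous fun ε : ℝ => ((ε, (0, 0)) : ℝ × (X × ℝ))).tendsto' _ _ rfl
  obtain ⟨ε₀, hε₀, hsub⟩ := Metric.eventually_nhds_iff.1 (hcont.eventually hball)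
  refine ⟨‖((g, c₀) : X × ℝ)‖ + 1, ε₀, by positivity, hε₀, fun ε hε => ?_⟩
  obtain ⟨⟨ε', y⟩, hy, hFy⟩ := hsub (y := ε) (by simpa using hε)
  simp only [hF, Prod.mk.injEq] at hFy
  obtain ⟨rfl, hy1, hy2⟩ := hFy
  refine ⟨y, ?_, ?_, hy2⟩
  · have : dist y (g, c₀) < 1 := lt_of_le_of_lt (le_max_right _ _) hy
    have h2 := norm_le_norm_add_norm_sub' y ((g, c₀) : X × ℝ)
    rw [dist_eq_norm] at this
    linarith
  · rw [sub_sub, sub_eq_zero] at hy1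
    exact hy1

/-! ### The scalar reduced equation and its solution near the kink. -/

/-- The linear coupling of the reduced equation acting on a 2-jet `(w, w', w'')`. -/
noncomputable def couplingOp (lamM lamM' lamE lamE' γ q r : ℝ) :
    (ℝ →ᵇ ℝ) × (ℝ →ᵇ ℝ) × (ℝ →ᵇ ℝ) →L[ℝ] (ℝ →ᵇ ℝ) :=
  (lamE' • reflectOp q + lamE • reflectOp r) ∘L ContinuousLinearMap.fst ℝ _ _ +
  ((-γ) • ContinuousLinearMap.id ℝ _).comp
    ((ContinuousLinearMap.fst ℝ _ _) ∘L ContinuousLinearMap.snd ℝ _ _) +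
  (lamM' • reflectOp q + lamM • reflectOp r) ∘L
    ((ContinuousLinearMap.snd ℝ _ _) ∘L ContinuousLinearMap.snd ℝ _ _)

lemma couplingOp_apply (lamM lamM' lamE lamE' γ q r : ℝ) (w w1 w2 : ℝ →ᵇ ℝ) (x : ℝ) :
    couplingOp lamM lamM' lamE lamE' γ q r (w, w1, w2) x =
      lamM' * w2 (q - x) + lamM * w2 (r - x) + lamE' * w (q - x) + lamE * w (r - x) - γ * w1 x := by
  simp [couplingOp]; ring

/-- The derivative of `bell` as a bounded continuous function. -/
noncomputable def slopeB : ℝ →ᵇ ℝ := (-√2) • (profileB * bellB)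

lemma slopeB_apply (x : ℝ) : slopeB x = -(√2 * profile x * bell x) := by
  simp [slopeB]; ring

/-- The 2-jet of `profile`. -/
noncomputable def profileJet : (ℝ →ᵇ ℝ) × (ℝ →ᵇ ℝ) × (ℝ →ᵇ ℝ) :=
  (profileB, bellB, slopeB)

/-- The potential `3 * profile ^ 2 - 1` of the linearisation about the kink. -/
noncomputable def potentialB : ℝ →ᵇ ℝ := (3 : ℝ) • (profileB * profileB) - 1

lemma potentialB_apply (x : ℝ) : potentialB x = 3 * profile x ^ 2 - 1 := by
  simp [potentialB]; ring

/-- The 2-jet of `bell`. -/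
noncomputable def bellJet : (ℝ →ᵇ ℝ) × (ℝ →ᵇ ℝ) × (ℝ →ᵇ ℝ) :=
  (bellB, slopeB, potentialB * bellB)

lemma slope_eq (x : ℝ) : -(√2 * profile x * bell x) = profile x ^ 3 - profile x := by
  linear_combination (-profile x) * sqrt_two_mul_bell x

/-- The bounded solution of `w'' + (1 - 3 * profile ^ 2) * w = meanFree f` with component `c` along
the kernel function `bell`. -/
noncomputable def corrOp : (ℝ →ᵇ ℝ) × ℝ →L[ℝ] (ℝ →ᵇ ℝ) :=
  stableOp ∘L unstableOp ∘L ContinuousLinearMap.fst ℝ _ _ +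
    (ContinuousLinearMap.snd ℝ (ℝ →ᵇ ℝ) ℝ).smulRight bellB

/-- The derivative of `corrOp`. -/
noncomputable def corrOp1 : (ℝ →ᵇ ℝ) × ℝ →L[ℝ] (ℝ →ᵇ ℝ) :=
  unstableOp ∘L ContinuousLinearMap.fst ℝ _ _ -
    √2 • (ContinuousLinearMap.mul ℝ (ℝ →ᵇ ℝ) profileB) ∘L corrOp

/-- The second derivative of `corrOp`. -/
noncomputable def corrOp2 : (ℝ →ᵇ ℝ) × ℝ →L[ℝ] (ℝ →ᵇ ℝ) :=
  meanFree ∘L ContinuousLinearMap.fst ℝ _ _ +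
    (ContinuousLinearMap.mul ℝ (ℝ →ᵇ ℝ) potentialB) ∘L corrOp

lemma corrOp_apply (y : (ℝ →ᵇ ℝ) × ℝ) (x : ℝ) :
    corrOp y x = stableOp (unstableOp y.1) x + y.2 * bell x := by
  simp [corrOp]

lemma corrOp1_apply (y : (ℝ →ᵇ ℝ) × ℝ) (x : ℝ) :
    corrOp1 y x = unstableOp y.1 x - √2 * profile x * corrOp y x := by
  simp [corrOp1]; ring

lemma corrOp2_apply (y : (ℝ →ᵇ ℝ) × ℝ) (x : ℝ) :
    corrOp2 y x = meanFree y.1 x + (3 * profile x ^ 2 - 1) * corrOp y x := by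
  simp [corrOp2, potentialB_apply]

lemma hasDerivAt_corrOp (y : (ℝ →ᵇ ℝ) × ℝ) (x : ℝ) : HasDerivAt (corrOp y) (corrOp1 y x) x := by
  have e : (corrOp y : ℝ → ℝ) = fun x => stableOp (unstableOp y.1) x + y.2 * bell x :=
    funext (corrOp_apply y)
  rw [corrOp1_apply, corrOp_apply, e]
  refine ((hasDerivAt_stableOp (unstableOp y.1) x).add
    ((hasDerivAt_bell x).const_mul y.2)).congr_deriv ?_
  ring

lemma hasDerivAt_corrOp1 (y : (ℝ →ᵇ ℝ) × ℝ) (x : ℝ) :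
    HasDerivAt (corrOp1 y) (corrOp2 y x) x := by
  have e : (corrOp1 y : ℝ → ℝ) = fun x => unstableOp y.1 x - √2 * profile x * corrOp y x :=
    funext (corrOp1_apply y)
  rw [corrOp2_apply, e]
  refine ((hasDerivAt_unstableOp y.1 x).sub
    (((hasDerivAt_profile x).const_mul √2).mul (hasDerivAt_corrOp y x))).congr_deriv ?_
  rw [corrOp1_apply]
  linear_combination (profile x ^ 2 * corrOp y x) * sqrt_two_mul_self - corrOp y x * sqrt_two_mul_bell x

lemma tendsto_bell_mul_zero (f : ℝ →ᵇ ℝ) {l : Filter ℝ} (hl : Tendsto bell l (𝓝 0)) :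
    Tendsto (fun x => bell x * f x) l (𝓝 0) :=
  hl.zero_mul_isBoundedUnder_le
    (isBoundedUnder_of ⟨‖f‖, fun x => by simpa using f.norm_coe_le_norm x⟩)

/-- Solvability identity: pairing the quadratic term with `bell` differentiates the Melnikov
function. -/
lemma integral_bell_sq_mul_corrOp (y : (ℝ →ᵇ ℝ) × ℝ) (hy : bellMean y.1 = 0) :
    ∫ x, bell x * (6 * profile x * bell x * corrOp y x) = ∫ x, slopeB x * y.1 x := by
  -- Differentiating `L bell = 0`, where `L` is the linearisation, gives `L bell' = 6 profile
  -- bell²`, and `L` is symmetric. Here `bell * G` is the Wronskian `bell' w' - bell'' w` of `w =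
  -- corrOp y` and `bell'`; it vanishes at `±∞`.
  set h : ℝ →ᵇ ℝ := (-√2) • (profileB * y.1) - (6 : ℝ) • (profileB * bellB * corrOp y) with hh
  set G : ℝ →ᵇ ℝ := (-√2) • (profileB * corrOp1 y) - potentialB * corrOp y with hG
  have hd : ∀ x, HasDerivAt (fun x => bell x * G x) (bell x * h x) x := by
    intro x
    have e : (G : ℝ → ℝ) = fun x => -√2 * (profile x * corrOp1 y x) -
        (3 * profile x ^ 2 - 1) * corrOp y x := by
      funext x; simp [hG, potentialB_apply]
    rw [e]
    refine ((hasDerivAt_bell x).mul ((((hasDerivAt_profile x).mul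
      (hasDerivAt_corrOp1 y x)).const_mul (-√2)).sub (((((hasDerivAt_profile x).pow 2).const_mul
      3).sub_const 1).mul (hasDerivAt_corrOp y x)))).congr_deriv ?_
    simp [hh, corrOp2_apply, meanFree_apply, hy]
    linear_combination (profile x ^ 2 * bell x * corrOp1 y x) * sqrt_two_mul_self
      - (bell x * corrOp1 y x) * sqrt_two_mul_bell x
  have hi := integral_of_hasDerivAt_of_tendsto hd (integrable_bell_mul h)
    (tendsto_bell_mul_zero G tendsto_bell_atBot) (tendsto_bell_mul_zero G tendsto_bell_atTop)
  have e1 : ∀ x, bell x * h x = slopeB x * y.1 x - bell x * (6 * profile x * bell x * corrOp y x) := by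
    intro x; simp [hh, slopeB_apply]; ring
  have i1 : Integrable fun x => bell x * (6 * profile x * bell x * corrOp y x) := by
    refine (integrable_bell_mul ((6 : ℝ) • (profileB * bellB * corrOp y))).congr
      (Eventually.of_forall fun x => ?_)
    simp [-mul_eq_mul_left_iff]; ring
  have i2 : Integrable fun x => slopeB x * y.1 x := by
    refine (integrable_bell_mul ((-√2) • (profileB * y.1))).congr (Eventually.of_forall fun x => ?_)
    simp [slopeB_apply]; ring
  simp_rw [e1] at hi
  rw [integral_sub i2 i1] at hi
  linarith

lemma bellMean_odd (f : ℝ →ᵇ ℝ) (hf : ∀ x, f (-x) = -f x) : bellMean f = 0 := by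
  have h := integral_neg_eq_self (fun x => bell x * f x) (volume : Measure ℝ)
  simp only [bell_neg, hf, mul_neg, integral_neg] at h
  rw [bellMean_apply]; linarith

/-- The time-periodic forcing in coordinates centred at the kink. -/
noncomputable def sineB (Ω τ : ℝ) : ℝ →ᵇ ℝ :=
  BoundedContinuousFunction.ofNormedAddCommGroup (fun x => Real.sin (Ω * (x + τ))) (by fun_prop) 1
    fun _ => Real.abs_sin_le_one _

@[simp] lemma sineB_apply (Ω τ x : ℝ) : sineB Ω τ x = Real.sin (Ω * (x + τ)) := rfl

/-- After division by `ε`, the equation for `w` reads `L w = f` with `f = g + ε (C(jet of w) + 3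
profile w² + ε w³)`. The unknowns are `f` and the component `c` of `w` along `bell`. As `g` has
`bellMean` zero, the solvability condition can be divided by `ε` once more, and at `ε = 0` it
becomes a scalar equation for `c`. For the coupling and forcing used below, the quantity in `hJ` is
`-M'(τ)`: integrate the `slopeB` term by parts. -/
lemma exists_corrected_kink (C : (ℝ →ᵇ ℝ) × (ℝ →ᵇ ℝ) × (ℝ →ᵇ ℝ) →L[ℝ] (ℝ →ᵇ ℝ)) (s : ℝ →ᵇ ℝ)
    (hM : bellMean (C profileJet + s) = 0)
    (hJ : bellMean (C bellJet) + (∫ x, slopeB x * (C profileJet + s) x) / 2 ≠ 0) :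
    ∃ R ε₀ : ℝ, 0 < R ∧ 0 < ε₀ ∧ ∀ ε : ℝ, |ε| < ε₀ → ∃ w w1 w2 : ℝ →ᵇ ℝ,
      ‖w‖ ≤ R ∧ ‖w1‖ ≤ R ∧ (∀ x, HasDerivAt w (w1 x) x) ∧ (∀ x, HasDerivAt w1 (w2 x) x) ∧
      ∀ x, (slopeB x + ε * w2 x) + (profile x + ε * w x) - (profile x + ε * w x) ^ 3 =
        ε * (C (profileJet + ε • (w, w1, w2)) x + s x) := by
  set g := C profileJet + s with hg
  set N : (ℝ →ᵇ ℝ) × ℝ →L[ℝ] (ℝ →ᵇ ℝ) := C ∘L (corrOp.prod (corrOp1.prod corrOp2)) with hN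
  have hS1 : corrOp (0, 1) = bellB := by ext x; simp [corrOp_apply]
  have hN1 : N (0, 1) = C bellJet := by
    have e1 : corrOp1 (0, 1) = slopeB := by ext x; simp [corrOp1_apply, hS1, slopeB_apply]
    have e2 : corrOp2 (0, 1) = potentialB * bellB := by
      ext x; simp [corrOp2_apply, hS1, potentialB_apply]
    simp [hN, hS1, e1, e2, bellJet]
  set k : ℝ →ᵇ ℝ := (3 : ℝ) • profileB with hk
  -- The slope in `c` does not depend on `c`, because `integral_bell_sq_mul_corrOp` expresses the
  -- quadratic contribution through `g` alone.
  have hJ' : ∀ c : ℝ, bellMean (N (0, 1) + (2 : ℝ) • (k * (corrOp (g, c) * corrOp (0, 1)))) =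
      bellMean (C bellJet) + (∫ x, slopeB x * g x) / 2 := by
    intro c
    rw [map_add, hN1, ← integral_bell_sq_mul_corrOp (g, c) hM, bellMean_apply (_ • _)]
    congr 2
    refine integral_congr_ae (Eventually.of_forall fun x => ?_)
    simp [hk, hS1, -mul_eq_mul_left_iff]; ring
  set J := bellMean (C bellJet) + (∫ x, slopeB x * g x) / 2 with hJd
  set H := bellMean (N (g, 0) + k * (corrOp (g, 0) * corrOp (g, 0))) with hH
  -- This is the coefficient of `c²`. Its vanishing makes the bifurcation equation affine in `c`,
  -- with root `-H / J`.
  have hodd : bellMean (k * (bellB * bellB)) = 0 :=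
    bellMean_odd _ fun x => by simp [hk, profile_neg, bell_neg]
  have h0 : bellMean (N (g, -H / J) + k * (corrOp (g, -H / J) * corrOp (g, -H / J))) = 0 := by
    set c := -H / J with hc
    have e : ((g, c) : (ℝ →ᵇ ℝ) × ℝ) = (g, 0) + c • (0, 1) := by simp
    have e3 : N (g, c) + k * (corrOp (g, c) * corrOp (g, c)) =
        (N (g, 0) + k * (corrOp (g, 0) * corrOp (g, 0))) +
        c • (N (0, 1) + (2 : ℝ) • (k * (corrOp (g, 0) * corrOp (0, 1)))) +
        (c ^ 2) • (k * (bellB * bellB)) := by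
      rw [e, N.map_add, corrOp.map_add, N.map_smul, corrOp.map_smul, hS1]
      ext x; simp; ring
    rw [e3, map_add, map_add, map_smul, map_smul, hodd, hJ', ← hH, hc]
    simp only [smul_eq_mul, mul_zero, add_zero]
    rw [div_mul_cancel₀ _ hJ]
    ring
  obtain ⟨R, ε₀, hR, hε₀, hsol⟩ := exists_solution_of_nondegenerate corrOp N bellMean k g (-H / J) h0
    (by rw [hJ']; exact hJ)
  refine ⟨(‖corrOp‖ + ‖corrOp1‖ + 1) * R, ε₀, by positivity, hε₀, fun ε hε => ?_⟩
  obtain ⟨y, hyR, hy, hym⟩ := hsol ε hε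
  refine ⟨corrOp y, corrOp1 y, corrOp2 y, ?_, ?_, hasDerivAt_corrOp y, hasDerivAt_corrOp1 y, ?_⟩
  · refine (corrOp.le_opNorm y).trans (mul_le_mul ?_ hyR (norm_nonneg _) (by positivity))
    linarith [norm_nonneg corrOp1]
  · refine (corrOp1.le_opNorm y).trans (mul_le_mul ?_ hyR (norm_nonneg _) (by positivity))
    linarith [norm_nonneg corrOp]
  · intro x
    have hm : bellMean y.1 = 0 := by
      rw [hy, map_add, map_smul, hym, hM]; simp
    have hyx := DFunLike.congr_fun hy x
    rw [map_add, map_smul, corrOp2_apply, meanFree_apply, hm, hyx]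
    simp only [hg, hk, hN, BoundedContinuousFunction.add_apply, BoundedContinuousFunction.coe_smul,
      BoundedContinuousFunction.mul_apply, smul_eq_mul, ContinuousLinearMap.comp_apply,
      ContinuousLinearMap.prod_apply, profileB_apply]
    rw [slopeB_apply, slope_eq]
    ring

/-! ### The Fourier transform of `bell` and the forcing integrals. -/

lemma half_one_add_profile (x : ℝ) :
    (1 + profile x) / 2 = Real.exp (x / √2 - Real.log (2 * Real.cosh (x / √2))) := by
  have h := Real.cosh_pos (x / √2)
  rw [Real.exp_sub, Real.exp_log (by positivity), profile, Real.tanh_eq_sinh_div_cosh,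
    ← Real.cosh_add_sinh (x / √2)]
  field_simp

lemma half_one_sub_profile (x : ℝ) :
    (1 - profile x) / 2 = Real.exp (-(x / √2) - Real.log (2 * Real.cosh (x / √2))) := by
  have h := half_one_add_profile (-x)
  rwa [profile_neg, neg_div, Real.cosh_neg, ← sub_eq_add_neg] at h

lemma strictMono_profile : StrictMono profile :=
  strictMono_of_hasDerivAt_pos hasDerivAt_profile bell_pos

lemma image_half_one_add_profile :
    (fun x => (1 + profile x) / 2) '' Set.univ = Set.Ioo 0 1 := by
  ext y
  constructor
  · rintro ⟨x, -, rfl⟩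
    have h1 := profile_lt_one x
    have h2 := neg_one_lt_profile x
    constructor <;> simp only <;> linarith
  · rintro ⟨h0, h1⟩
    obtain ⟨x, -, hx⟩ := Real.tanh_surjOn (show 2 * y - 1 ∈ Set.Ioo (-1 : ℝ) 1 by
      constructor <;> linarith)
    refine ⟨√2 * x, trivial, ?_⟩
    simp only [profile]
    rw [mul_div_cancel_left₀ _ sqrt_two_pos.ne', hx]
    ring

/-- Substitute `t = (1 + profile x) / 2`, which maps the line onto `(0, 1)`. Then `t / (1 - t) =
exp(√2 x)`, so the oscillating factor is `t^(iω) (1 - t)^(-iω)`. -/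
lemma integral_bell_mul_cexp (ω : ℝ) :
    ∫ x, (bell x : ℂ) * Complex.exp ((√2 * ω * x : ℝ) * Complex.I) =
      2 * Complex.betaIntegral (1 + ω * Complex.I) (1 - ω * Complex.I) := by
  have hd : ∀ x ∈ Set.univ, HasDerivWithinAt (fun x => (1 + profile x) / 2) (bell x / 2)
      Set.univ x := fun x _ =>
    (((hasDerivAt_profile x).const_add 1).div_const 2).hasDerivWithinAt
  have hinj : Set.InjOn (fun x => (1 + profile x) / 2) Set.univ := fun x _ y _ h => by
    simp only at h
    exact strictMono_profile.injective (by linarith)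
  have h := integral_image_eq_integral_abs_deriv_smul MeasurableSet.univ hd hinj
    (fun t : ℝ => (t : ℂ) ^ (ω * Complex.I) * (1 - (t : ℂ)) ^ (-(ω * Complex.I)))
  rw [image_half_one_add_profile, setIntegral_univ] at h
  rw [Complex.betaIntegral, intervalIntegral.integral_of_le zero_le_one,
    integral_Ioc_eq_integral_Ioo]
  have e1 : (1 + (ω : ℂ) * Complex.I - 1) = ω * Complex.I := by ring
  have e2 : (1 - (ω : ℂ) * Complex.I - 1) = -(ω * Complex.I) := by ring
  rw [e1, e2, h, ← integral_const_mul]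
  refine integral_congr_ae (Eventually.of_forall fun x => ?_)
  simp only
  have e3 : (1 : ℂ) - (((1 + profile x) / 2 : ℝ) : ℂ) = ((1 - profile x) / 2 : ℝ) := by
    push_cast; ring
  rw [e3, half_one_add_profile, half_one_sub_profile, Complex.cpow_def_of_ne_zero (by simp),
    Complex.cpow_def_of_ne_zero (by simp), ← Complex.ofReal_log (Real.exp_pos _).le,
    ← Complex.ofReal_log (Real.exp_pos _).le, Real.log_exp, Real.log_exp, ← Complex.exp_add,
    abs_of_pos (by have := bell_pos x; positivity), Complex.real_smul]
  have e4 : √2 * ω * x = 2 * (x / √2) * ω := by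
    field_simp; rw [Real.sq_sqrt (by norm_num)]; ring
  rw [e4]
  push_cast
  rw [← mul_assoc]
  congr 1
  · ring
  · congr 1; ring

/-- The Beta–Gamma relation with `Γ(2) = 1`, followed by `Γ(1 + iω) = iω Γ(iω)` and the reflection
formula. -/
lemma betaIntegral_conj_pair {ω : ℝ} (hω : 0 < ω) :
    Complex.betaIntegral (1 + ω * Complex.I) (1 - ω * Complex.I) =
      (Real.pi * ω / Real.sinh (Real.pi * ω) : ℝ) := by
  have h := Complex.Gamma_mul_Gamma_eq_betaIntegral (s := 1 + ω * Complex.I)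
    (t := 1 - ω * Complex.I) (by simp) (by simp)
  have e : (1 + ω * Complex.I) + (1 - ω * Complex.I) = 1 + 1 := by ring
  have hω' : (ω : ℂ) * Complex.I ≠ 0 := by
    simp [hω.ne']
  rw [e, Complex.Gamma_add_one _ one_ne_zero, Complex.Gamma_one, mul_one, one_mul, add_comm (1 : ℂ),
    Complex.Gamma_add_one _ hω', mul_assoc, Complex.Gamma_mul_Gamma_one_sub] at h
  rw [add_comm, ← h, ← mul_assoc, Complex.sin_mul_I]
  have hs : Complex.sinh (Real.pi * ω) ≠ 0 := by
    have : Real.sinh (Real.pi * ω) ≠ 0 := (Real.sinh_pos_iff.2 (by positivity)).ne'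
    exact_mod_cast this
  push_cast
  field_simp

/-- Half the Fourier transform of `bell`. -/
noncomputable def bellFourier (Ω : ℝ) : ℝ := (Ω * Real.pi / √2) * (Real.sinh (Ω * Real.pi / √2))⁻¹

lemma bellFourier_pos {Ω : ℝ} (hΩ : 0 < Ω) : 0 < bellFourier Ω := by
  have : 0 < Ω * Real.pi / √2 := by positivity
  exact mul_pos this (inv_pos.2 (Real.sinh_pos_iff.2 this))

lemma integrable_mul_bcf {w : ℝ → ℝ} (hw : Integrable w) (f : ℝ →ᵇ ℝ) :
    Integrable fun x => w x * f x := by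
  simp_rw [fun x => mul_comm (w x) (f x)]
  exact hw.bdd_mul (c := ‖f‖) f.continuous.aestronglyMeasurable
    (Eventually.of_forall f.norm_coe_le_norm)

lemma integral_bell_mul_cos {Ω : ℝ} (hΩ : 0 < Ω) :
    ∫ x, bell x * Real.cos (Ω * x) = 2 * bellFourier Ω := by
  have h := integral_bell_mul_cexp (Ω / √2)
  rw [betaIntegral_conj_pair (by positivity)] at h
  have hc := congrArg Complex.re h
  have hi : Integrable fun x : ℝ =>
      (bell x : ℂ) * Complex.exp ((√2 * (Ω / √2) * x : ℝ) * Complex.I) := by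
    have hb := continuous_bell
    refine integrable_bell.mono (by fun_prop : Continuous _).aestronglyMeasurable
      (Eventually.of_forall fun x => ?_)
    rw [norm_mul, Complex.norm_exp_ofReal_mul_I, mul_one, Complex.norm_real]
  have hre := integral_re hi
  simp only [RCLike.re_eq_complex_re, Complex.re_ofReal_mul, Complex.exp_ofReal_mul_I_re] at hre
  rw [← hre] at hc
  have e1 : ∀ x, √2 * (Ω / √2) * x = Ω * x := fun x => by field_simp
  simp_rw [e1] at hc
  rw [hc, ← Complex.ofReal_ofNat, ← Complex.ofReal_mul, Complex.ofReal_re, bellFourier]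
  have e2 : Real.pi * (Ω / √2) = Ω * Real.pi / √2 := by ring
  rw [e2, div_eq_mul_inv (Ω * Real.pi / √2) (Real.sinh _)]

/-- An odd function has integral zero. -/
lemma integral_odd (f : ℝ → ℝ) (hf : ∀ x, f (-x) = -f x) : ∫ x, f x = 0 := by
  have h := integral_neg_eq_self f (volume : Measure ℝ)
  simp only [hf, integral_neg] at h
  linarith

lemma integrable_bell_mul_sin (Ω τ : ℝ) : Integrable fun x => bell x * Real.sin (Ω * (x + τ)) :=
  integrable_bell_mul (sineB Ω τ)

lemma integrable_bell_mul_cos (Ω τ : ℝ) : Integrable fun x => bell x * Real.cos (Ω * (x + τ)) :=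
  integrable_bell_mul (BoundedContinuousFunction.ofNormedAddCommGroup
    (fun x => Real.cos (Ω * (x + τ))) (by fun_prop) 1 fun _ => Real.abs_cos_le_one _)

lemma integral_bell_mul_sin {Ω : ℝ} (hΩ : 0 < Ω) (τ : ℝ) :
    ∫ x, bell x * Real.sin (Ω * (x + τ)) = 2 * bellFourier Ω * Real.sin (Ω * τ) := by
  have h1 := integrable_bell_mul_sin Ω 0
  have h2 := integrable_bell_mul_cos Ω 0
  simp only [add_zero] at h1 h2
  have e : ∀ x, bell x * Real.sin (Ω * (x + τ)) = bell x * Real.sin (Ω * x) * Real.cos (Ω * τ) +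
      bell x * Real.cos (Ω * x) * Real.sin (Ω * τ) := fun x => by
    rw [mul_add, Real.sin_add]; ring
  simp_rw [e]
  rw [integral_add (h1.mul_const _) (h2.mul_const _), integral_mul_const, integral_mul_const,
    integral_bell_mul_cos hΩ, integral_odd _ fun x => by simp [bell_neg]]
  ring

lemma integral_bell_mul_cos_add {Ω : ℝ} (hΩ : 0 < Ω) (τ : ℝ) :
    ∫ x, bell x * Real.cos (Ω * (x + τ)) = 2 * bellFourier Ω * Real.cos (Ω * τ) := by
  have h1 := integrable_bell_mul_sin Ω 0
  have h2 := integrable_bell_mul_cos Ω 0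
  simp only [add_zero] at h1 h2
  have e : ∀ x, bell x * Real.cos (Ω * (x + τ)) = bell x * Real.cos (Ω * x) * Real.cos (Ω * τ) -
      bell x * Real.sin (Ω * x) * Real.sin (Ω * τ) := fun x => by
    rw [mul_add, Real.cos_add]; ring
  simp_rw [e]
  rw [integral_sub (h2.mul_const _) (h1.mul_const _), integral_mul_const, integral_mul_const,
    integral_bell_mul_cos hΩ, integral_odd _ fun x => by simp [bell_neg]]
  ring

lemma integrable_slopeB : Integrable slopeB := by
  refine (integrable_bell_mul ((-√2) • profileB)).congr (Eventually.of_forall fun x => ?_)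
  simp [slopeB]; ring

lemma integral_slopeB_mul_sin {Ω : ℝ} (hΩ : 0 < Ω) (τ : ℝ) :
    ∫ x, slopeB x * Real.sin (Ω * (x + τ)) = -(2 * Ω * bellFourier Ω * Real.cos (Ω * τ)) := by
  have hd : ∀ x, HasDerivAt (fun x => bell x * Real.sin (Ω * (x + τ)))
      (slopeB x * Real.sin (Ω * (x + τ)) + Ω * (bell x * Real.cos (Ω * (x + τ)))) x := by
    intro x
    refine ((hasDerivAt_bell x).mul (((hasDerivAt_id x).add_const τ).const_mul Ω).sin).congr_deriv ?_
    simp [slopeB_apply]; ring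
  have i1 : Integrable fun x => slopeB x * Real.sin (Ω * (x + τ)) :=
    integrable_mul_bcf integrable_slopeB (sineB Ω τ)
  have i2 := (integrable_bell_mul_cos Ω τ).const_mul Ω
  have h := integral_of_hasDerivAt_of_tendsto hd (i1.add i2)
    (tendsto_bell_mul_zero (sineB Ω τ) tendsto_bell_atBot)
    (tendsto_bell_mul_zero (sineB Ω τ) tendsto_bell_atTop)
  rw [integral_add i1 i2, integral_const_mul, integral_bell_mul_cos_add hΩ] at h
  linarith

/-! ### The Melnikov function for widely separated kinks. -/

lemma tendsto_integral_reflect {w : ℝ → ℝ} (hw : Integrable w) (f : ℝ →ᵇ ℝ) {l : Filter ℝ} {L : ℝ}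
    (hf : Tendsto f l (𝓝 L)) {q : ℝ → ℝ} (hq : ∀ x, Tendsto (fun t => q t - x) atTop l) :
    Tendsto (fun t => ∫ x, w x * f (q t - x)) atTop (𝓝 (L * ∫ x, w x)) := by
  rw [mul_comm, ← integral_mul_const]
  refine tendsto_integral_filter_of_dominated_convergence (fun x => ‖w x‖ * ‖f‖)
    (Eventually.of_forall fun t => (integrable_mul_bcf hw (reflectOp (q t) f)).1)
    (Eventually.of_forall fun t => Eventually.of_forall fun x => ?_) (hw.norm.mul_const _)
    (Eventually.of_forall fun x => (hf.comp (hq x)).const_mul _)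
  rw [norm_mul]
  exact mul_le_mul_of_nonneg_left (f.norm_coe_le_norm _) (norm_nonneg _)

lemma continuous_integral_reflect {w : ℝ → ℝ} (hw : Integrable w) (f : ℝ →ᵇ ℝ) {q : ℝ → ℝ}
    (hq : Continuous q) : Continuous fun t => ∫ x, w x * f (q t - x) := by
  refine continuous_of_dominated (bound := fun x => ‖w x‖ * ‖f‖)
    (fun t => (integrable_mul_bcf hw (reflectOp (q t) f)).1)
    (fun t => Eventually.of_forall fun x => ?_) (hw.norm.mul_const _)
    (Eventually.of_forall fun x => ?_)
  · rw [norm_mul]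
    exact mul_le_mul_of_nonneg_left (f.norm_coe_le_norm _) (norm_nonneg _)
  · have := f.continuous
    fun_prop

lemma integral_mul_couplingOp {w : ℝ → ℝ} (hw : Integrable w) (lamM lamM' lamE lamE' γ q r : ℝ)
    (f f1 f2 : ℝ →ᵇ ℝ) :
    ∫ x, w x * couplingOp lamM lamM' lamE lamE' γ q r (f, f1, f2) x =
      lamM' * (∫ x, w x * f2 (q - x)) + lamM * (∫ x, w x * f2 (r - x)) +
      lamE' * (∫ x, w x * f (q - x)) + lamE * (∫ x, w x * f (r - x)) - γ * ∫ x, w x * f1 x := by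
  have i1 := (integrable_mul_bcf hw (reflectOp q f2)).const_mul lamM'
  have i2 := (integrable_mul_bcf hw (reflectOp r f2)).const_mul lamM
  have i3 := (integrable_mul_bcf hw (reflectOp q f)).const_mul lamE'
  have i4 := (integrable_mul_bcf hw (reflectOp r f)).const_mul lamE
  have i5 := (integrable_mul_bcf hw f1).const_mul γ
  simp only [reflectOp_apply] at i1 i2 i3 i4
  have i12 : Integrable fun x => lamM' * (w x * f2 (q - x)) + lamM * (w x * f2 (r - x)) := i1.add i2
  have i13 : Integrable fun x => lamM' * (w x * f2 (q - x)) + lamM * (w x * f2 (r - x)) +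
    lamE' * (w x * f (q - x)) := i12.add i3
  have i14 : Integrable fun x => lamM' * (w x * f2 (q - x)) + lamM * (w x * f2 (r - x)) +
    lamE' * (w x * f (q - x)) + lamE * (w x * f (r - x)) := i13.add i4
  simp only [← integral_const_mul]
  rw [← integral_add i1 i2, ← integral_add i12 i3, ← integral_add i13 i4, ← integral_sub i14 i5]
  refine integral_congr_ae (Eventually.of_forall fun x => ?_)
  simp only [couplingOp_apply]
  ring

lemma tendsto_integral_mul_couplingOp {w : ℝ → ℝ} (hw : Integrable w)
    (lamM lamM' lamE lamE' γ : ℝ) (f f1 f2 : ℝ →ᵇ ℝ) {l : Filter ℝ} {L : ℝ} (hf : Tendsto f l (𝓝 L))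
    (hf2 : Tendsto f2 l (𝓝 0)) {q r : ℝ → ℝ} (hq : ∀ x, Tendsto (fun t => q t - x) atTop l)
    (hr : ∀ x, Tendsto (fun t => r t - x) atTop l) :
    Tendsto (fun t => ∫ x, w x * couplingOp lamM lamM' lamE lamE' γ (q t) (r t) (f, f1, f2) x) atTop
      (𝓝 ((lamE + lamE') * (L * ∫ x, w x) - γ * ∫ x, w x * f1 x)) := by
  simp_rw [integral_mul_couplingOp hw]
  have h := (((((tendsto_integral_reflect hw f2 hf2 hq).const_mul lamM').add
    ((tendsto_integral_reflect hw f2 hf2 hr).const_mul lamM)).add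
    ((tendsto_integral_reflect hw f hf hq).const_mul lamE')).add
    ((tendsto_integral_reflect hw f hf hr).const_mul lamE)).sub_const (γ * ∫ x, w x * f1 x)
  convert h using 2
  ring

lemma continuous_integral_mul_couplingOp {w : ℝ → ℝ} (hw : Integrable w)
    (lamM lamM' lamE lamE' γ : ℝ) (f f1 f2 : ℝ →ᵇ ℝ) {q r : ℝ → ℝ} (hq : Continuous q)
    (hr : Continuous r) : Continuous fun t =>
      ∫ x, w x * couplingOp lamM lamM' lamE lamE' γ (q t) (r t) (f, f1, f2) x := by
  simp_rw [integral_mul_couplingOp hw]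
  have h1 := continuous_integral_reflect hw f2 hq
  have h2 := continuous_integral_reflect hw f2 hr
  have h3 := continuous_integral_reflect hw f hq
  have h4 := continuous_integral_reflect hw f hr
  fun_prop

/-- A small perturbation of `a * sin (Ω * t)` has a zero at which a given small perturbation of
`b * cos (Ω * t)` does not vanish. -/
lemma exists_zero_sin_add {a b Ω : ℝ} (ha : 0 < a) (hb : b ≠ 0) (hΩ : 0 < Ω) {k j : ℝ → ℝ}
    (hk : Continuous k) {k₀ : ℝ} (hk₀ : Tendsto k atTop (𝓝 k₀)) (hka : |k₀| < a)
    (hj : Tendsto j atTop (𝓝 0)) :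
    ∃ t, a * Real.sin (Ω * t) + k t = 0 ∧ b * Real.cos (Ω * t) + j t ≠ 0 := by
  -- On the window `Ω t ∈ [-α, α] + 2πn` with `sin α = s`, the sine term runs from `-s a` to `s a`
  -- and so overcomes `k`, while `cos(Ω t) ≥ cos α > 0` keeps the cosine term larger than `j`. A
  -- large `n` pushes the window beyond `T`.
  obtain ⟨s, hs1, hs2⟩ := exists_between ((div_lt_one ha).2 hka)
  have hs0 : 0 ≤ s := le_trans (by positivity) hs1.le
  rw [div_lt_iff₀ ha] at hs1
  set α := Real.arcsin s with hα
  have hsin : Real.sin α = s := Real.sin_arcsin (by linarith) hs2.le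
  have hα0 : 0 ≤ α := Real.arcsin_nonneg.2 hs0
  have hα1 : α < Real.pi / 2 := Real.arcsin_lt_pi_div_two.2 hs2
  have hcos : 0 < Real.cos α := Real.cos_pos_of_mem_Ioo ⟨by linarith, hα1⟩
  have ek : ∀ᶠ t in atTop, |k t| < s * a := hk₀.abs.eventually_lt_const hs1
  have ej : ∀ᶠ t in atTop, |j t| < |b| * Real.cos α :=
    hj.abs.eventually_lt_const (by rw [abs_zero]; positivity)
  obtain ⟨T, hT⟩ := eventually_atTop.1 (ek.and ej)
  obtain ⟨n, hn⟩ := exists_nat_ge ((Ω * |T| + α) / (2 * Real.pi))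
  rw [div_le_iff₀ (by positivity)] at hn
  have hge : ∀ θ ∈ Set.Icc (-α) α, T ≤ (θ + n * (2 * Real.pi)) / Ω := by
    intro θ hθ
    rw [le_div_iff₀ hΩ]
    have := mul_le_mul_of_nonneg_left (le_abs_self T) hΩ.le
    linarith [hθ.1]
  have hc : ContinuousOn (fun θ => a * Real.sin θ + k ((θ + n * (2 * Real.pi)) / Ω))
      (Set.Icc (-α) α) := by fun_prop
  have h1 := (hT _ (hge (-α) ⟨le_rfl, by linarith⟩)).1
  have h2 := (hT _ (hge α ⟨by linarith, le_rfl⟩)).1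
  obtain ⟨θ, hθ, h0⟩ := intermediate_value_Icc (by linarith) hc (show (0 : ℝ) ∈ Set.Icc _ _ from by
    simp only [Real.sin_neg, hsin]
    rw [abs_lt] at h1 h2
    constructor <;> nlinarith)
  refine ⟨(θ + n * (2 * Real.pi)) / Ω, ?_, ?_⟩
  · rw [mul_div_cancel₀ _ hΩ.ne', Real.sin_add_nat_mul_two_pi]
    exact h0
  · rw [mul_div_cancel₀ _ hΩ.ne', Real.cos_add_nat_mul_two_pi]
    have h3 := (hT _ (hge θ hθ)).2
    have h4 : Real.cos α ≤ Real.cos θ := by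
      rw [← Real.cos_abs θ]
      exact Real.cos_le_cos_of_nonneg_of_le_pi (abs_nonneg _) (by linarith [Real.pi_pos])
        (abs_le.2 hθ)
    intro h5
    have h6 : |b * Real.cos θ| = |j ((θ + n * (2 * Real.pi)) / Ω)| := by
      rw [eq_neg_of_add_eq_zero_left h5, abs_neg]
    rw [abs_mul, abs_of_nonneg (hcos.le.trans h4)] at h6
    have := mul_le_mul_of_nonneg_left h4 (abs_nonneg b)
    linarith

/-- Far out in `τ`, the `λ_M`-terms vanish and the `λ_E`-terms see a constant, so both quantities
are asymptotic to those of a shifted sine: `M` is nearly a constant plus `β sin(Ωτ)`, and the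
nondegeneracy quantity nearly `-Ω β cos(Ωτ)`. -/
lemma exists_simple_melnikov_zero (lamM lamM' lamE lamE' γ p : ℝ) {Ω : ℝ} (hΩ : 0 < Ω)
    (h : |(lamE + lamE') - √2 * γ / 3| < bellFourier Ω ∨
      |-(lamE + lamE') - √2 * γ / 3| < bellFourier Ω) :
    ∃ τ : ℝ,
      bellMean (couplingOp lamM lamM' lamE lamE' γ (p - 2 * τ) (-2 * τ) profileJet + sineB Ω τ) = 0 ∧
      bellMean (couplingOp lamM lamM' lamE lamE' γ (p - 2 * τ) (-2 * τ) bellJet) +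
        (∫ x, slopeB x * (couplingOp lamM lamM' lamE lamE' γ (p - 2 * τ) (-2 * τ) profileJet +
          sineB Ω τ) x) / 2 ≠ 0 := by
  -- The sign `σ` is the direction in which `τ = σ t` goes to infinity. The reflected argument goes
  -- the opposite way, where `profile` tends to `-σ`; this produces the sign in front of `λ_E +
  -- λ_E'`.
  obtain ⟨σ, l, hσ, hlim, hK, hb⟩ : ∃ (σ : ℝ) (l : Filter ℝ), σ * σ = 1 ∧
      (∀ c, Tendsto (fun t => c - 2 * (σ * t)) atTop l) ∧ Tendsto profile l (𝓝 (-σ)) ∧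
      |-σ * (lamE + lamE') - √2 * γ / 3| < bellFourier Ω := by
    rcases h with h | h
    · refine ⟨-1, atTop, by norm_num, fun c => ?_, by simpa using tendsto_profile_atTop, ?_⟩
      · have := tendsto_atTop_add_const_left atTop c (tendsto_id.const_mul_atTop (two_pos (α := ℝ)))
        exact this.congr fun t => by simp
      · simpa using h
    · refine ⟨1, atBot, by norm_num, fun c => ?_, by simpa using tendsto_profile_atBot, ?_⟩
      · have := tendsto_atBot_add_const_left atTop c
          (tendsto_id.const_mul_atTop_of_neg (show (-2 : ℝ) < 0 by norm_num))
        exact this.congr fun t => by simp; ring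
      · simpa using h
  have hbell : Tendsto bell l (𝓝 0) := by
    have h := ((hK.pow 2).const_sub 1).div_const √2
    rw [neg_sq, sq, hσ, sub_self, zero_div] at h
    exact h
  have hslope : Tendsto slopeB l (𝓝 0) := by
    refine (tendsto_bell_mul_zero ((-√2) • profileB) hbell).congr fun x => ?_
    simp [slopeB_apply]; ring
  have hcurv : Tendsto (potentialB * bellB) l (𝓝 0) :=
    (tendsto_bell_mul_zero potentialB hbell).congr fun x => by simp [mul_comm]
  have hq : ∀ x, Tendsto (fun t => (p - 2 * (σ * t)) - x) atTop l := fun x =>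
    (hlim (p - x)).congr fun t => by ring
  have hr : ∀ x, Tendsto (fun t => (-2 * (σ * t)) - x) atTop l := fun x =>
    (hlim (-x)).congr fun t => by ring
  have hqc : Continuous fun t => p - 2 * (σ * t) := by fun_prop
  have hrc : Continuous fun t => -2 * (σ * t) := by fun_prop
  set k : ℝ → ℝ := fun t => (∫ x, bell x *
    couplingOp lamM lamM' lamE lamE' γ (p - 2 * (σ * t)) (-2 * (σ * t)) profileJet x) / 2 with hk
  set j : ℝ → ℝ := fun t => (∫ x, bell x *
    couplingOp lamM lamM' lamE lamE' γ (p - 2 * (σ * t)) (-2 * (σ * t)) bellJet x) / 2 +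
    (∫ x, slopeB x *
    couplingOp lamM lamM' lamE lamE' γ (p - 2 * (σ * t)) (-2 * (σ * t)) profileJet x) / 2 with hj
  have hkc : Continuous k := (continuous_integral_mul_couplingOp integrable_bell lamM lamM' lamE lamE'
    γ profileB bellB slopeB hqc hrc).div_const 2
  have hklim := (tendsto_integral_mul_couplingOp integrable_bell lamM lamM' lamE lamE' γ
    profileB bellB slopeB hK hslope hq hr).div_const 2
  have hjlim1 := (tendsto_integral_mul_couplingOp integrable_bell lamM lamM' lamE lamE' γ
    bellB slopeB (potentialB * bellB) hbell hcurv hq hr).div_const 2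
  have hjlim2 := (tendsto_integral_mul_couplingOp integrable_slopeB lamM lamM' lamE lamE' γ
    profileB bellB slopeB hK hslope hq hr).div_const 2
  have o1 : ∫ x, slopeB x = 0 := integral_odd _ fun x => by
    simp [slopeB_apply, profile_neg, bell_neg]
  have o2 : ∫ x, bell x * slopeB x = 0 := integral_odd _ fun x => by
    simp [slopeB_apply, profile_neg, bell_neg]
  have o3 : ∫ x, slopeB x * bellB x = 0 := integral_odd _ fun x => by
    simp [slopeB_apply, profile_neg, bell_neg]
  have hsq : ∫ x, bell x * bellB x = 2 * √2 / 3 := integral_bell_sq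
  rw [integral_bell, hsq] at hklim
  rw [o2] at hjlim1
  rw [o1, o3] at hjlim2
  have hj0 : Tendsto j atTop (𝓝 0) := by
    have h := hjlim1.add hjlim2
    simp only [mul_zero, zero_mul, sub_zero, zero_div, add_zero] at h
    exact h
  have hσk : Tendsto (fun t => σ * k t) atTop
      (𝓝 (σ * (-σ * (lamE + lamE') - √2 * γ / 3))) := by
    refine Tendsto.const_mul σ ?_
    have e : -σ * (lamE + lamE') - √2 * γ / 3 =
        ((lamE + lamE') * (-σ * 2) - γ * (2 * √2 / 3)) / 2 := by ring
    rw [e]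
    exact hklim
  have hσabs : |σ| = 1 := by
    have := abs_mul_abs_self σ
    rw [hσ] at this
    nlinarith [abs_nonneg σ]
  -- As `sin(Ωσt) = σ sin(Ωt)`, the Melnikov function at `σ t` is `σ` times `β sin(Ωt) + σ k t`.
  obtain ⟨t, ht1, ht2⟩ := exists_zero_sin_add (bellFourier_pos hΩ)
    (b := -(Ω * bellFourier Ω)) (neg_ne_zero.2 (mul_pos hΩ (bellFourier_pos hΩ)).ne') hΩ
    (hkc.const_mul σ) hσk (by rw [abs_mul, hσabs, one_mul]; exact hb) hj0
  have hsc : Real.sin (Ω * (σ * t)) = σ * Real.sin (Ω * t) ∧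
      Real.cos (Ω * (σ * t)) = Real.cos (Ω * t) := by
    rcases mul_self_eq_one_iff.1 hσ with rfl | rfl <;> simp
  refine ⟨σ * t, ?_, ?_⟩
  · rw [map_add, bellMean_apply, bellMean_apply]
    simp only [sineB_apply]
    rw [integral_bell_mul_sin hΩ, hsc.1]
    change k t + _ = 0
    linear_combination σ * ht1 - k t * hσ
  · intro h0
    apply ht2
    have e : ∀ x, slopeB x * (couplingOp lamM lamM' lamE lamE' γ (p - 2 * (σ * t)) (-2 * (σ * t))
        profileJet + sineB Ω (σ * t)) x =
        slopeB x * couplingOp lamM lamM' lamE lamE' γ (p - 2 * (σ * t)) (-2 * (σ * t))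
        profileJet x + slopeB x * Real.sin (Ω * (x + σ * t)) := fun x => by
      simp; ring
    have i2 : Integrable fun x => slopeB x * Real.sin (Ω * (x + σ * t)) :=
      integrable_mul_bcf integrable_slopeB (sineB Ω (σ * t))
    simp_rw [e] at h0
    rw [integral_add (integrable_mul_bcf integrable_slopeB _) i2, integral_slopeB_mul_sin hΩ, hsc.2,
      bellMean_apply] at h0
    rw [hj]
    linear_combination h0

end

/-! ### Decay on half-lines for perturbations of `w'' = 2w`. -/

lemma monotoneOn_Ici_of_hasDerivAt {f f' : ℝ → ℝ} {S : ℝ} (hf : ∀ z, HasDerivAt f (f' z) z)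
    (h : ∀ z, S ≤ z → 0 ≤ f' z) : MonotoneOn f (Set.Ici S) := by
  refine monotoneOn_of_deriv_nonneg (convex_Ici S)
    (fun z _ => (hf z).continuousAt.continuousWithinAt)
    (fun z _ => (hf z).differentiableAt.differentiableWithinAt) fun z hz => ?_
  rw [interior_Ici] at hz
  rw [(hf z).deriv]
  exact h z hz.le

lemma hasDerivAt_exp_mul (c z : ℝ) : HasDerivAt (fun z => Real.exp (c * z)) (c * Real.exp (c * z)) z :=
  (((hasDerivAt_id z).const_mul c).exp).congr_deriv (by simp; ring)

/-- One-sided decay estimate for bounded solutions of `w'' - 2 * w ≥ -κ` on a half-line. -/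
lemma le_of_hyperbolic {w w1 w2 : ℝ → ℝ} (hw : ∀ z, HasDerivAt w (w1 z) z)
    (hw1 : ∀ z, HasDerivAt w1 (w2 z) z) {S κ m : ℝ} (hκ : 0 ≤ κ) (hm : ∀ z, S ≤ z → |w z| ≤ m)
    (hm1 : ∀ z, S ≤ z → |w1 z| ≤ m) (hg : ∀ z, S ≤ z → -κ ≤ w2 z - 2 * w z) {z : ℝ} (hz : S ≤ z) :
    w z ≤ κ / 2 + m * Real.exp (-√2 * (z - S)) := by
  have h2 := sqrt_two_mul_self
  have hs := sqrt_two_pos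
  have hm0 : 0 ≤ m := (abs_nonneg _).trans (hm S le_rfl)
  have hκ2 : √2 * (κ / √2) = κ := by field_simp
  -- Use `D² - 2 = (D - √2)(D + √2)`. Boundedness at `+∞` rules out the growing mode of the first
  -- factor; the second is then integrated forward from `S`.
  have key : ∀ z, S ≤ z → w1 z + √2 * w z ≤ κ / √2 := by
    intro z hz
    set a : ℝ → ℝ := fun z => Real.exp (-√2 * z) * (w1 z + √2 * w z - κ / √2) with ha
    have hd : ∀ z, HasDerivAt a (Real.exp (-√2 * z) * (w2 z - 2 * w z + κ)) z := fun z => by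
      refine ((hasDerivAt_exp_mul (-√2) z).mul
        (((hw1 z).add ((hw z).const_mul √2)).sub_const (κ / √2))).congr_deriv ?_
      simp only [Pi.add_apply]
      linear_combination (Real.exp (-√2 * z)) * (hκ2 - w z * h2)
    have hmono : MonotoneOn a (Set.Ici S) := monotoneOn_Ici_of_hasDerivAt hd fun z hz =>
      mul_nonneg (Real.exp_pos _).le (by linarith [hg z hz])
    have hlim : Tendsto (fun z => Real.exp (-√2 * z) * (m + √2 * m)) atTop (𝓝 0) := by
      have h := (Real.tendsto_exp_neg_atTop_nhds_zero.comp
        (tendsto_id.const_mul_atTop hs)).mul_const (m + √2 * m)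
      rw [zero_mul] at h
      exact h.congr fun z => by simp
    have hle : a z ≤ 0 := by
      refine ge_of_tendsto hlim ?_
      filter_upwards [eventually_ge_atTop z] with y hy
      refine (hmono hz (hz.trans hy) hy).trans (mul_le_mul_of_nonneg_left ?_ (Real.exp_pos _).le)
      have h3 := (abs_le.1 (hm1 y (hz.trans hy))).2
      have h4 := mul_le_mul_of_nonneg_left (abs_le.1 (hm y (hz.trans hy))).2 hs.le
      have h5 : 0 ≤ κ / √2 := by positivity
      linarith
    have := nonpos_of_mul_nonpos_right hle (Real.exp_pos _)
    linarith
  set b : ℝ → ℝ := fun z => Real.exp (√2 * z) * (κ / 2 - w z) with hb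
  have hd : ∀ z, HasDerivAt b (Real.exp (√2 * z) * (κ / √2 - (w1 z + √2 * w z))) z := fun z => by
    refine ((hasDerivAt_exp_mul √2 z).mul ((hw z).const_sub (κ / 2))).congr_deriv ?_
    have h3 : κ / √2 = √2 * (κ / 2) := by
      field_simp; nlinarith
    rw [h3]; ring
  have hmono : MonotoneOn b (Set.Ici S) := monotoneOn_Ici_of_hasDerivAt hd fun z hz =>
    mul_nonneg (Real.exp_pos _).le (by linarith [key z hz])
  have h3 := hmono (Set.mem_Ici.2 le_rfl) hz hz
  simp only [hb] at h3
  have e : Real.exp (√2 * S) = Real.exp (√2 * z) * Real.exp (-√2 * (z - S)) := by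
    rw [← Real.exp_add]; congr 1; ring
  rw [e, mul_assoc] at h3
  have h4 := le_of_mul_le_mul_left h3 (Real.exp_pos _)
  have h5 : -m ≤ κ / 2 - w S := by linarith [(abs_le.1 (hm S le_rfl)).2]
  have h6 := mul_le_mul_of_nonneg_left h5 (Real.exp_pos (-√2 * (z - S))).le
  linarith

lemma abs_le_of_hyperbolic {w w1 w2 : ℝ → ℝ} (hw : ∀ z, HasDerivAt w (w1 z) z)
    (hw1 : ∀ z, HasDerivAt w1 (w2 z) z) {S κ m : ℝ} (hκ : 0 ≤ κ) (hm : ∀ z, S ≤ z → |w z| ≤ m)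
    (hm1 : ∀ z, S ≤ z → |w1 z| ≤ m) (hg : ∀ z, S ≤ z → |w2 z - 2 * w z| ≤ κ) {z : ℝ} (hz : S ≤ z) :
    |w z| ≤ κ / 2 + m * Real.exp (-√2 * (z - S)) := by
  refine abs_le'.2 ⟨le_of_hyperbolic hw hw1 hκ hm hm1 (fun z hz => (abs_le.1 (hg z hz)).1) hz, ?_⟩
  refine le_of_hyperbolic (w := fun z => -w z) (fun z => (hw z).neg) (fun z => (hw1 z).neg) hκ
    (by simpa using hm) (by simpa using hm1) (fun z hz => ?_) hz
  linarith [(abs_le.1 (hg z hz)).2]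

/-- Interpolation bound for the first derivative. -/
lemma abs_deriv_le_of_bounds {w w1 w2 : ℝ → ℝ} (hw : ∀ z, HasDerivAt w (w1 z) z)
    (hw1 : ∀ z, HasDerivAt w1 (w2 z) z) {S a b : ℝ} (ha : ∀ z, S ≤ z → |w z| ≤ a)
    (hb : ∀ z, S ≤ z → |w2 z| ≤ b) {z : ℝ} (hz : S ≤ z) : |w1 z| ≤ 2 * a + b := by
  obtain ⟨x, hx, hx1⟩ := exists_hasDerivAt_eq_slope w w1 (show z < z + 1 by linarith)
    (fun y _ => (hw y).continuousAt.continuousWithinAt) fun y _ => hw y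
  obtain ⟨y, hy, hy1⟩ := exists_hasDerivAt_eq_slope w1 w2 hx.1
    (fun y _ => (hw1 y).continuousAt.continuousWithinAt) fun y _ => hw1 y
  have hxz : 0 < x - z := by linarith [hx.1]
  rw [add_sub_cancel_left, div_one] at hx1
  rw [eq_div_iff hxz.ne'] at hy1
  have h1 := ha z hz
  have h2 := ha (z + 1) (by linarith)
  have h3 : |w2 y * (x - z)| ≤ b := by
    rw [abs_mul, abs_of_pos hxz]
    have := hb y (by linarith [hy.1])
    nlinarith [hx.2, abs_nonneg (w2 y)]
  rw [hy1, hx1] at h3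
  rw [abs_le] at *
  constructor <;> linarith [h1.1, h1.2, h2.1, h2.2, h3.1, h3.2]

/-- `m` bounds the 2-jets of a family of functions on the half-line `[S, ∞)`. -/
def JetBound {ι : Type*} (w w1 w2 : ι → ℝ → ℝ) (S m : ℝ) : Prop :=
  ∀ i z, S ≤ z → |w i z| ≤ m ∧ |w1 i z| ≤ m ∧ |w2 i z| ≤ m

/-- A bounded family whose defect in `w'' = 2 * w` is controlled, with a small constant and a
bounded delay, by the family itself tends to zero uniformly. -/
lemma jetBound_arbitrarily_small {ι : Type*} [Nonempty ι] {w w1 w2 : ι → ℝ → ℝ}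
    (hw : ∀ i z, HasDerivAt (w i) (w1 i z) z) (hw1 : ∀ i z, HasDerivAt (w1 i) (w2 i z) z)
    {S₀ d m₀ : ℝ} (hd : 0 ≤ d) (h0 : JetBound w w1 w2 S₀ m₀)
    (hg : ∀ S m, S₀ ≤ S → JetBound w w1 w2 S m →
      ∀ i z, S + d ≤ z → |w2 i z - 2 * w i z| ≤ m / 20) {η : ℝ} (hη : 0 < η) :
    ∃ S, S₀ ≤ S ∧ JetBound w w1 w2 S η := by
  -- The defect and the exponential tail after length `40` each give at most `m / 40`, so `|w| ≤ m /
  -- 20`. Hence `|w''| ≤ 3m / 20`, and interpolation gives `|w'| ≤ m / 4`.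
  have step : ∀ S m, S₀ ≤ S → JetBound w w1 w2 S m → JetBound w w1 w2 (S + d + 40) (m / 2) := by
    intro S m hS hm i z hz
    have hm0 : 0 ≤ m := (abs_nonneg _).trans (hm i S le_rfl).1
    have hw0 : ∀ z, S + d + 40 ≤ z → |w i z| ≤ m / 20 := by
      intro z hz
      have h := abs_le_of_hyperbolic (hw i) (hw1 i) (S := S + d) (κ := m / 20) (by positivity)
        (fun z hz => (hm i z (by linarith)).1) (fun z hz => (hm i z (by linarith)).2.1)
        (hg S m hS hm i) (show S + d ≤ z by linarith)
      have he : Real.exp (-√2 * (z - (S + d))) ≤ 1 / 40 := by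
        rw [neg_mul, Real.exp_neg, one_div]
        refine inv_anti₀ (by norm_num) ?_
        have h1 := Real.add_one_le_exp (√2 * (z - (S + d)))
        have h2 : (1 : ℝ) ≤ √2 := Real.one_le_sqrt.2 (by norm_num)
        nlinarith
      have := mul_le_mul_of_nonneg_left he hm0
      linarith
    have hw2 : ∀ z, S + d + 40 ≤ z → |w2 i z| ≤ 3 * m / 20 := by
      intro z hz
      have h1 := hg S m hS hm i z (by linarith)
      have h2 := hw0 z hz
      rw [abs_le] at *
      constructor <;> linarith [h1.1, h1.2, h2.1, h2.2]
    have h1 := abs_deriv_le_of_bounds (hw i) (hw1 i) hw0 hw2 hz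
    have h2 := hw0 z hz
    have h3 := hw2 z hz
    exact ⟨by linarith, by linarith, by linarith⟩
  have iter : ∀ n : ℕ, ∃ S, S₀ ≤ S ∧ JetBound w w1 w2 S (m₀ * (1 / 2) ^ n) := by
    intro n
    induction n with
    | zero => exact ⟨S₀, le_rfl, by simpa using h0⟩
    | succ n ih =>
      obtain ⟨S, hS, h⟩ := ih
      refine ⟨S + d + 40, by linarith, ?_⟩
      have := step S _ hS h
      rwa [pow_succ, ← mul_assoc, mul_one_div]
  have hlim : Tendsto (fun n : ℕ => m₀ * (1 / 2 : ℝ) ^ n) atTop (𝓝 0) := by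
    have := (tendsto_pow_atTop_nhds_zero_of_lt_one (r := (1 / 2 : ℝ)) (by norm_num)
      (by norm_num)).const_mul m₀
    rwa [mul_zero] at this
  obtain ⟨n, hn⟩ := (hlim.eventually_le_const hη).exists
  obtain ⟨S, hS, h⟩ := iter n
  exact ⟨S, hS, fun i z hz => ⟨(h i z hz).1.trans hn, (h i z hz).2.1.trans hn,
    (h i z hz).2.2.trans hn⟩⟩

/-! ### Periodic limits of asymptotically periodic functions. -/

/-- Translates of `f` by multiples of `T` form a Cauchy sequence, uniformly near `+∞`. -/
def AsymptoticallyPeriodic (T : ℝ) (f : ℝ → ℝ) : Prop :=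
  ∀ η : ℝ, 0 < η → ∃ S : ℝ, ∀ z, S ≤ z → ∀ k : ℕ, |f (z + k * T) - f z| ≤ η

/-- The periodic limit of `f` at `+∞`. -/
noncomputable def periodicLimit (T : ℝ) (f : ℝ → ℝ) (z : ℝ) : ℝ :=
  limUnder atTop fun n : ℕ => f (z + n * T)

namespace AsymptoticallyPeriodic

variable {T : ℝ} {f : ℝ → ℝ}

lemma tendsto (hf : AsymptoticallyPeriodic T f) (hT : 0 < T) (z : ℝ) :
    Tendsto (fun n : ℕ => f (z + n * T)) atTop (𝓝 (periodicLimit T f z)) := by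
  refine CauchySeq.tendsto_limUnder (Metric.cauchySeq_iff'.2 fun η hη => ?_)
  obtain ⟨S, hS⟩ := hf (η / 2) (by positivity)
  obtain ⟨N, hN⟩ := exists_nat_ge ((S - z) / T)
  rw [div_le_iff₀ hT] at hN
  refine ⟨N, fun n hn => ?_⟩
  have h := hS (z + N * T) (by linarith) (n - N)
  rw [Nat.cast_sub hn] at h
  have e : z + N * T + (n - N) * T = z + n * T := by ring
  rw [e] at h
  rw [Real.dist_eq]
  linarith

lemma periodic (hf : AsymptoticallyPeriodic T f) (hT : 0 < T) :
    Function.Periodic (periodicLimit T f) T := by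
  intro z
  refine tendsto_nhds_unique (hf.tendsto hT (z + T)) ?_
  refine ((hf.tendsto hT z).comp (tendsto_add_atTop_nat 1)).congr fun n => ?_
  simp only [Function.comp_apply]
  congr 1
  push_cast
  ring

lemma exists_abs_sub_le (hf : AsymptoticallyPeriodic T f) (hT : 0 < T) {η : ℝ} (hη : 0 < η) :
    ∃ S : ℝ, ∀ z, S ≤ z → |f z - periodicLimit T f z| ≤ η := by
  obtain ⟨S, hS⟩ := hf η hη
  refine ⟨S, fun z hz => ?_⟩
  rw [abs_sub_comm]
  exact le_of_tendsto ((hf.tendsto hT z).sub_const (f z)).abs (Eventually.of_forall (hS z hz))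

lemma tendsto_sub (hf : AsymptoticallyPeriodic T f) (hT : 0 < T) :
    Tendsto (fun z => f z - periodicLimit T f z) atTop (𝓝 0) := by
  refine Metric.tendsto_atTop.2 fun η hη => ?_
  obtain ⟨S, hS⟩ := hf.exists_abs_sub_le hT (half_pos hη)
  exact ⟨S, fun z hz => by simpa using (hS z hz).trans_lt (half_lt_self hη)⟩

lemma tendstoUniformlyOn (hf : AsymptoticallyPeriodic T f) (hT : 0 < T) (a : ℝ) :
    TendstoUniformlyOn (fun (n : ℕ) z => f (z + n * T)) (periodicLimit T f) atTop (Set.Ioi a) := by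
  refine Metric.tendstoUniformlyOn_iff.2 fun η hη => ?_
  obtain ⟨S, hS⟩ := hf.exists_abs_sub_le hT (half_pos hη)
  obtain ⟨N, hN⟩ := exists_nat_ge ((S - a) / T)
  rw [div_le_iff₀ hT] at hN
  filter_upwards [eventually_ge_atTop N] with n hn z hz
  have h1 : (N : ℝ) * T ≤ n * T := mul_le_mul_of_nonneg_right (by exact_mod_cast hn) hT.le
  have h := hS (z + n * T) (by linarith [Set.mem_Ioi.1 hz])
  rw [(hf.periodic hT).nat_mul n z] at h
  rw [dist_comm, Real.dist_eq]
  linarith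

lemma hasDerivAt {f1 : ℝ → ℝ} (hf : AsymptoticallyPeriodic T f) (hf1 : AsymptoticallyPeriodic T f1)
    (hT : 0 < T) (hd : ∀ z, HasDerivAt f (f1 z) z) (z : ℝ) :
    HasDerivAt (periodicLimit T f) (periodicLimit T f1 z) z :=
  hasDerivAt_of_tendstoUniformlyOn isOpen_Ioi (hf1.tendstoUniformlyOn hT (z - 1))
    (Eventually.of_forall fun n x _ => by
      simpa using (hd (x + n * T)).comp_add_const x (n * T))
    (fun x _ => hf.tendsto hT x) (show z - 1 < z by linarith)

lemma continuous (hf : AsymptoticallyPeriodic T f) (hT : 0 < T) (hc : Continuous f) :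
    Continuous (periodicLimit T f) := by
  refine continuous_iff_continuousAt.2 fun z => ?_
  have h := (hf.tendstoUniformlyOn hT (z - 1)).continuousOn
    (Eventually.of_forall fun n => by fun_prop : ∀ᶠ n : ℕ in atTop, _).frequently
  exact h.continuousAt (Ioi_mem_nhds (by linarith))

end AsymptoticallyPeriodic

/-! ### Waves as pairs of half-systems, and their asymptotic periodicity. -/

/-- `f1` and `f2` are the first two derivatives of the twice continuously differentiable `f`. -/
def IsJet (f f1 f2 : ℝ → ℝ) : Prop :=
  (∀ z, HasDerivAt f (f1 z) z) ∧ (∀ z, HasDerivAt f1 (f2 z) z) ∧ Continuous f2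

lemma IsJet.deriv_eq {f f1 f2 : ℝ → ℝ} (h : IsJet f f1 f2) : deriv f = f1 :=
  funext fun z => (h.1 z).deriv

lemma IsJet.deriv_deriv_eq {f f1 f2 : ℝ → ℝ} (h : IsJet f f1 f2) : deriv (deriv f) = f2 := by
  rw [h.deriv_eq]
  exact funext fun z => (h.2.1 z).deriv

lemma IsJet.contDiff {f f1 f2 : ℝ → ℝ} (h : IsJet f f1 f2) : ContDiff ℝ 2 f := by
  rw [show (2 : WithTop ℕ∞) = 1 + 1 from by norm_num, contDiff_succ_iff_deriv]
  refine ⟨fun z => (h.1 z).differentiableAt, by simp, ?_⟩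
  rw [h.deriv_eq, contDiff_one_iff_deriv]
  refine ⟨fun z => (h.2.1 z).differentiableAt, ?_⟩
  rw [← h.deriv_eq, h.deriv_deriv_eq]
  exact h.2.2

/-- The first equation of the wave system with `a = 0`, `β = -1`, in terms of 2-jets. -/
def IsHalfWave (lamM lamM' lamE lamE' γ Ω p ε : ℝ) (U U1 U2 V V2 : ℝ → ℝ) : Prop :=
  ∀ z, U2 z + U z - U z ^ 3 = ε * (-lamM' * V2 (z - p) - lamM * V2 z - lamE' * V (z - p)
    - lamE * V z - γ * U1 z + Real.sin (Ω * z))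

lemma isWaveSolution_of_isHalfWave {lamM lamM' lamE lamE' γ Ω p ε : ℝ} {U U1 U2 V V1 V2 : ℝ → ℝ}
    (hU : IsJet U U1 U2) (hV : IsJet V V1 V2)
    (h1 : IsHalfWave lamM lamM' lamE lamE' γ Ω p ε U U1 U2 V V2)
    (h2 : IsHalfWave lamM lamM' lamE lamE' (-γ) Ω (-p) ε V V1 V2 U U2) :
    IsWaveSolution 0 (-1) lamM lamM' lamE lamE' γ Ω p ε U V := by
  refine ⟨hU.contDiff, hV.contDiff, fun z => ?_, fun z => ?_⟩
  · rw [hU.deriv_deriv_eq, hV.deriv_deriv_eq, hU.deriv_eq]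
    linear_combination h1 z
  · have := h2 z
    rw [sub_neg_eq_add] at this
    rw [hU.deriv_deriv_eq, hV.deriv_deriv_eq, hV.deriv_eq]
    linear_combination this

lemma sin_add_nat_mul_period {Ω : ℝ} (hΩ : 0 < Ω) (z : ℝ) (k : ℕ) :
    Real.sin (Ω * (z + k * (2 * Real.pi / Ω))) = Real.sin (Ω * z) := by
  have e : Ω * (z + k * (2 * Real.pi / Ω)) = Ω * z + k * (2 * Real.pi) := by field_simp
  rw [e, Real.sin_add_nat_mul_two_pi]

lemma IsHalfWave.periodicLimit {lamM lamM' lamE lamE' γ Ω p ε : ℝ} {U U1 U2 V V2 : ℝ → ℝ}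
    (hΩ : 0 < Ω) (h : IsHalfWave lamM lamM' lamE lamE' γ Ω p ε U U1 U2 V V2)
    (hU : AsymptoticallyPeriodic (2 * Real.pi / Ω) U)
    (hU1 : AsymptoticallyPeriodic (2 * Real.pi / Ω) U1)
    (hU2 : AsymptoticallyPeriodic (2 * Real.pi / Ω) U2)
    (hV : AsymptoticallyPeriodic (2 * Real.pi / Ω) V)
    (hV2 : AsymptoticallyPeriodic (2 * Real.pi / Ω) V2) :
    IsHalfWave lamM lamM' lamE lamE' γ Ω p ε (periodicLimit (2 * Real.pi / Ω) U)
      (periodicLimit (2 * Real.pi / Ω) U1) (periodicLimit (2 * Real.pi / Ω) U2)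
      (periodicLimit (2 * Real.pi / Ω) V) (periodicLimit (2 * Real.pi / Ω) V2) := by
  have hT : 0 < 2 * Real.pi / Ω := by positivity
  intro z
  refine tendsto_nhds_unique (((hU2.tendsto hT z).add (hU.tendsto hT z)).sub
    ((hU.tendsto hT z).pow 3)) ?_
  refine (((((((hV2.tendsto hT (z - p)).const_mul (-lamM')).sub
    ((hV2.tendsto hT z).const_mul lamM)).sub ((hV.tendsto hT (z - p)).const_mul lamE')).sub
    ((hV.tendsto hT z).const_mul lamE)).sub ((hU1.tendsto hT z).const_mul γ)).add_const
    (Real.sin (Ω * z))).const_mul ε |>.congr fun n => ?_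
  have := h (z + n * (2 * Real.pi / Ω))
  rw [sin_add_nat_mul_period hΩ, add_sub_right_comm z _ p] at this
  exact this.symm

/-- The forcing cancels between `z` and its translate. The linear part of `U - U³` at `1` is `-2(U -
1)`, so the defect consists of the higher-order terms of the cubic and the `ε`-coupling, each at
most `m / 40`. The shift by `p` is why the bound starts at `S + |p|`. -/
lemma abs_difference_defect_le {lamM lamM' lamE lamE' γ Ω p ε : ℝ} {U U1 U2 V V2 : ℝ → ℝ}
    (hΩ : 0 < Ω) (h : IsHalfWave lamM lamM' lamE lamE' γ Ω p ε U U1 U2 V V2)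
    (hε : |ε| * (|lamM| + |lamM'| + |lamE| + |lamE'| + |γ|) ≤ 1 / 40) {S₀ : ℝ}
    (hU1 : ∀ z, S₀ ≤ z → |U z - 1| ≤ 1 / 400) (k : ℕ) {S m z : ℝ} (hS : S₀ ≤ S)
    (hz : S + |p| ≤ z)
    (hmU : ∀ z, S ≤ z → |U (z + k * (2 * Real.pi / Ω)) - U z| ≤ m ∧
      |U1 (z + k * (2 * Real.pi / Ω)) - U1 z| ≤ m)
    (hmV : ∀ z, S ≤ z → |V (z + k * (2 * Real.pi / Ω)) - V z| ≤ m ∧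
      |V2 (z + k * (2 * Real.pi / Ω)) - V2 z| ≤ m) :
    |U2 (z + k * (2 * Real.pi / Ω)) - U2 z - 2 * (U (z + k * (2 * Real.pi / Ω)) - U z)|
      ≤ m / 20 := by
  set T := k * (2 * Real.pi / Ω) with hT
  have hT0 : 0 ≤ T := by positivity
  have hp := neg_abs_le p
  have hp' := le_abs_self p
  have hz0 : S ≤ z := by linarith [abs_nonneg p]
  have hzp : S ≤ z - p := by linarith
  have e1 := h z
  have e2 := h (z + T)
  rw [hT, sin_add_nat_mul_period hΩ, ← hT, add_sub_right_comm z T p] at e2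
  obtain ⟨b1, b2⟩ := hmU z hz0
  obtain ⟨b3, b4⟩ := hmV z hz0
  obtain ⟨b5, b6⟩ := hmV (z - p) hzp
  have ha := hU1 (z + T) (by linarith)
  have hb := hU1 z (by linarith)
  set s := U (z + T) - 1 with hs
  set t := U z - 1 with ht
  have hm0 : 0 ≤ m := (abs_nonneg _).trans b1
  set D := -lamM' * (V2 (z - p + T) - V2 (z - p)) - lamM * (V2 (z + T) - V2 z)
    - lamE' * (V (z - p + T) - V (z - p)) - lamE * (V (z + T) - V z)
    - γ * (U1 (z + T) - U1 z) with hD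
  have e3 : U2 (z + T) - U2 z - 2 * (U (z + T) - U z) =
      (U (z + T) - U z) * (3 * s + 3 * t + s * s + s * t + t * t) + ε * D := by
    have hs' : U (z + T) = 1 + s := by rw [hs]; ring
    have ht' : U z = 1 + t := by rw [ht]; ring
    rw [hs'] at e2 ⊢
    rw [ht'] at e1 ⊢
    rw [hD]
    linear_combination e2 - e1
  have c1 : |3 * s + 3 * t + s * s + s * t + t * t| ≤ 1 / 40 := by
    have q : ∀ x y : ℝ, |x| ≤ 1 / 400 → |y| ≤ 1 / 400 → |x * y| ≤ 1 / 400 := fun x y hx hy => by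
      rw [abs_mul]; nlinarith [abs_nonneg x, abs_nonneg y]
    have q1 := abs_le.1 (q s s ha ha)
    have q2 := abs_le.1 (q s t ha hb)
    have q3 := abs_le.1 (q t t hb hb)
    have q4 := abs_le.1 ha
    have q5 := abs_le.1 hb
    rw [abs_le]
    constructor <;> linarith [q1.1, q1.2, q2.1, q2.2, q3.1, q3.2, q4.1, q4.2, q5.1, q5.2]
  have c2 : |D| ≤ (|lamM| + |lamM'| + |lamE| + |lamE'| + |γ|) * m := by
    have q : ∀ x y : ℝ, |y| ≤ m → |x * y| ≤ |x| * m := fun x y hy => by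
      rw [abs_mul]; exact mul_le_mul_of_nonneg_left hy (abs_nonneg x)
    have q1 := abs_le.1 (q lamM' _ b6)
    have q2 := abs_le.1 (q lamM _ b4)
    have q3 := abs_le.1 (q lamE' _ b5)
    have q4 := abs_le.1 (q lamE _ b3)
    have q5 := abs_le.1 (q γ _ b2)
    rw [abs_le]
    constructor <;> linarith [q1.1, q1.2, q2.1, q2.2, q3.1, q3.2, q4.1, q4.2, q5.1, q5.2]
  rw [e3]
  calc _ ≤ |(U (z + T) - U z) * (3 * s + 3 * t + s * s + s * t + t * t)| + |ε * D| := abs_add_le _ _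
    _ ≤ m * (1 / 40) + |ε| * ((|lamM| + |lamM'| + |lamE| + |lamE'| + |γ|) * m) := by
      rw [abs_mul, abs_mul]
      exact add_le_add (mul_le_mul b1 c1 (abs_nonneg _) hm0)
        (mul_le_mul_of_nonneg_left c2 (abs_nonneg _))
    _ ≤ m / 20 := by
      rw [← mul_assoc]
      have := mul_le_mul_of_nonneg_right hε hm0
      linarith

/-- A bounded wave that is close to `1` near `+∞` is asymptotically periodic there. -/
lemma asymptoticallyPeriodic_of_isHalfWave {lamM lamM' lamE lamE' γ Ω p ε : ℝ}
    {U U1 U2 V V1 V2 : ℝ → ℝ} (hΩ : 0 < Ω) (hU : IsJet U U1 U2) (hV : IsJet V V1 V2)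
    (h1 : IsHalfWave lamM lamM' lamE lamE' γ Ω p ε U U1 U2 V V2)
    (h2 : IsHalfWave lamM lamM' lamE lamE' (-γ) Ω (-p) ε V V1 V2 U U2)
    (hε : |ε| * (|lamM| + |lamM'| + |lamE| + |lamE'| + |γ|) ≤ 1 / 40) {S₀ : ℝ}
    (hUc : ∀ z, S₀ ≤ z → |U z - 1| ≤ 1 / 400) (hVc : ∀ z, S₀ ≤ z → |V z - 1| ≤ 1 / 400)
    {m : ℝ} (hUm : ∀ z, |U z| ≤ m ∧ |U1 z| ≤ m ∧ |U2 z| ≤ m)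
    (hVm : ∀ z, |V z| ≤ m ∧ |V1 z| ≤ m ∧ |V2 z| ≤ m) :
    (AsymptoticallyPeriodic (2 * Real.pi / Ω) U ∧ AsymptoticallyPeriodic (2 * Real.pi / Ω) U1 ∧
      AsymptoticallyPeriodic (2 * Real.pi / Ω) U2) ∧
    AsymptoticallyPeriodic (2 * Real.pi / Ω) V ∧ AsymptoticallyPeriodic (2 * Real.pi / Ω) V1 ∧
      AsymptoticallyPeriodic (2 * Real.pi / Ω) V2 := by
  set T := 2 * Real.pi / Ω with hT
  -- The Boolean selects `U` or `V`, the natural number the translate. All differences form one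
  -- family because the equations are coupled and the estimate must be uniform in the translate.
  set W : Bool × ℕ → (ℝ → ℝ) → (ℝ → ℝ) → ℝ → ℝ := fun i f g z =>
    if i.1 then f (z + i.2 * T) - f z else g (z + i.2 * T) - g z with hW
  have hder : ∀ {f f' : ℝ → ℝ} (_ : ∀ z, HasDerivAt f (f' z) z) (k : ℕ) (z : ℝ),
      HasDerivAt (fun z => f (z + k * T) - f z) (f' (z + k * T) - f' z) z := fun hf k z =>
    ((hf (z + k * T)).comp_add_const z (k * T)).sub (hf z)
  have hWd : ∀ {f f' g g' : ℝ → ℝ} (_ : ∀ z, HasDerivAt f (f' z) z) (_ : ∀ z, HasDerivAt g (g' z) z)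
      (i : Bool × ℕ) (z : ℝ), HasDerivAt (W i f g) (W i f' g' z) z := by
    rintro f f' g g' hf hg ⟨b, k⟩ z
    cases b
    · exact hder hg k z
    · exact hder hf k z
  have hsub : ∀ {x y : ℝ}, |x| ≤ m → |y| ≤ m → |x - y| ≤ 2 * m := fun hx hy => by
    rw [abs_le] at *; constructor <;> linarith [hx.1, hx.2, hy.1, hy.2]
  have hbd : JetBound (fun i => W i U V) (fun i => W i U1 V1) (fun i => W i U2 V2) S₀ (2 * m) := by
    rintro ⟨b, k⟩ z -
    cases b
    · exact ⟨hsub (hVm _).1 (hVm _).1, hsub (hVm _).2.1 (hVm _).2.1, hsub (hVm _).2.2 (hVm _).2.2⟩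
    · exact ⟨hsub (hUm _).1 (hUm _).1, hsub (hUm _).2.1 (hUm _).2.1, hsub (hUm _).2.2 (hUm _).2.2⟩
  have hsmall : ∀ η : ℝ, 0 < η → ∃ S, S₀ ≤ S ∧
      JetBound (fun i => W i U V) (fun i => W i U1 V1) (fun i => W i U2 V2) S η := by
    intro η hη
    refine jetBound_arbitrarily_small (d := |p|) (fun i z => hWd hU.1 hV.1 i z)
      (fun i z => hWd hU.2.1 hV.2.1 i z) (abs_nonneg p) hbd ?_ hη
    rintro S μ hS hμ ⟨b, k⟩ z hz
    have hμU : ∀ z, S ≤ z → |U (z + k * T) - U z| ≤ μ ∧ |U1 (z + k * T) - U1 z| ≤ μ ∧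
      |U2 (z + k * T) - U2 z| ≤ μ := fun z hz => hμ (true, k) z hz
    have hμV : ∀ z, S ≤ z → |V (z + k * T) - V z| ≤ μ ∧ |V1 (z + k * T) - V1 z| ≤ μ ∧
      |V2 (z + k * T) - V2 z| ≤ μ := fun z hz => hμ (false, k) z hz
    cases b
    · exact abs_difference_defect_le hΩ h2 (by rwa [abs_neg]) hVc k hS
        (by rwa [abs_neg]) (fun z hz => ⟨(hμV z hz).1, (hμV z hz).2.1⟩)
        (fun z hz => ⟨(hμU z hz).1, (hμU z hz).2.2⟩)
    · exact abs_difference_defect_le hΩ h1 hε hUc k hS hz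
        (fun z hz => ⟨(hμU z hz).1, (hμU z hz).2.1⟩) (fun z hz => ⟨(hμV z hz).1, (hμV z hz).2.2⟩)
  refine ⟨⟨?_, ?_, ?_⟩, ?_, ?_, ?_⟩ <;> intro η hη <;> obtain ⟨S, -, hS⟩ := hsmall η hη <;>
    refine ⟨S, fun z hz k => ?_⟩
  · exact (hS (true, k) z hz).1
  · exact (hS (true, k) z hz).2.1
  · exact (hS (true, k) z hz).2.2
  · exact (hS (false, k) z hz).1
  · exact (hS (false, k) z hz).2.1
  · exact (hS (false, k) z hz).2.2

/-! ### Unperturbed kinks, and heteroclinic waves from reversibility. -/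

lemma isJet_kink (τ : ℝ) :
    IsJet (kink τ) (fun z => bell (z - τ)) fun z => slopeB (z - τ) := by
  refine ⟨fun z => (hasDerivAt_profile (z - τ)).comp_sub_const z τ, fun z => ?_, ?_⟩
  · simp only [slopeB_apply]
    exact (hasDerivAt_bell (z - τ)).comp_sub_const z τ
  · have := slopeB.continuous
    fun_prop

lemma isJet_const (c : ℝ) : IsJet (fun _ => c) (fun _ => 0) fun _ => 0 :=
  ⟨fun z => hasDerivAt_const z c, fun z => hasDerivAt_const z 0, continuous_const⟩

lemma isPeriodicWave_const (lamM lamM' lamE lamE' γ Ω p : ℝ) {c : ℝ} (hc : c ^ 3 = c) :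
    IsPeriodicWave 0 (-1) lamM lamM' lamE lamE' γ Ω p 0 (fun _ => c) (fun _ => c) := by
  refine ⟨isWaveSolution_of_isHalfWave (isJet_const c) (isJet_const c) (fun z => ?_) (fun z => ?_),
    fun _ => rfl, fun _ => rfl⟩ <;> rw [hc] <;> ring

lemma isHalfWave_kink (lamM lamM' lamE lamE' γ Ω p τ : ℝ) (V V2 : ℝ → ℝ) :
    IsHalfWave lamM lamM' lamE lamE' γ Ω p 0 (kink τ) (fun z => bell (z - τ))
      (fun z => slopeB (z - τ)) V V2 := fun z => by
  simp only [slopeB_apply, slope_eq, kink_eq_profile]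
  ring

lemma tendsto_dist_phase {U U1 V V1 P P1 Q Q1 : ℝ → ℝ} {l : Filter ℝ} (hU : deriv U = U1)
    (hV : deriv V = V1) (hP : deriv P = P1) (hQ : deriv Q = Q1)
    (h : Tendsto (fun z => U z - P z) l (𝓝 0)) (h1 : Tendsto (fun z => U1 z - P1 z) l (𝓝 0))
    (h' : Tendsto (fun z => V z - Q z) l (𝓝 0)) (h1' : Tendsto (fun z => V1 z - Q1 z) l (𝓝 0)) :
    Tendsto (fun z => dist (phase U V z) (phase P Q z)) l (𝓝 0) := by
  have key := h1.abs.max (h.abs.max (h1'.abs.max h'.abs))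
  simp only [abs_zero, max_self] at key
  refine key.congr fun z => ?_
  simp only [phase, Prod.dist_eq, Real.dist_eq, hU, hV, hP, hQ]

lemma dist_phase_lt {U U1 V V1 : ℝ → ℝ} (hU : deriv U = U1) (hV : deriv V = V1) {a b c d δ z : ℝ}
    (h1 : |U1 z - a| < δ) (h2 : |U z - b| < δ) (h3 : |V1 z - c| < δ) (h4 : |V z - d| < δ) :
    dist (phase U V z) (a, b, c, d) < δ := by
  simp only [phase, Prod.dist_eq, Real.dist_eq, hU, hV]
  exact max_lt h1 (max_lt h2 (max_lt h3 h4))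

lemma isHeteroclinicWave_kink (lamM lamM' lamE lamE' γ Ω p τ₁ τ₂ : ℝ) :
    IsHeteroclinicWave 0 (-1) lamM lamM' lamE lamE' γ Ω p 0
      (fun _ => -1) (fun _ => -1) (fun _ => 1) (fun _ => 1) (kink τ₁) (kink τ₂) := by
  have ht : ∀ τ : ℝ, Tendsto (fun z : ℝ => z - τ) atTop atTop := fun τ =>
    tendsto_atTop_add_const_right _ _ tendsto_id
  have hb : ∀ τ : ℝ, Tendsto (fun z : ℝ => z - τ) atBot atBot := fun τ =>
    tendsto_atBot_add_const_right _ _ tendsto_id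
  refine ⟨isPeriodicWave_const _ _ _ _ _ _ _ (by norm_num),
    isPeriodicWave_const _ _ _ _ _ _ _ (by norm_num),
    isWaveSolution_of_isHalfWave (isJet_kink τ₁) (isJet_kink τ₂)
      (isHalfWave_kink _ _ _ _ _ _ _ _ _ _) (isHalfWave_kink _ _ _ _ _ _ _ _ _ _), ?_, ?_⟩
  · have h0 : ∀ τ, Tendsto (fun z => kink τ z - -1) atBot (𝓝 0) := fun τ => by
      simpa [kink_eq_profile, Function.comp_def] using
        (tendsto_profile_atBot.comp (hb τ)).sub_const (-1)
    have h1 : ∀ τ, Tendsto (fun z => bell (z - τ) - 0) atBot (𝓝 0) := fun τ => by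
      simpa [Function.comp_def] using tendsto_bell_atBot.comp (hb τ)
    exact tendsto_dist_phase (isJet_kink τ₁).deriv_eq (isJet_kink τ₂).deriv_eq
      (isJet_const _).deriv_eq (isJet_const _).deriv_eq (h0 τ₁) (h1 τ₁) (h0 τ₂) (h1 τ₂)
  · have h0 : ∀ τ, Tendsto (fun z => kink τ z - 1) atTop (𝓝 0) := fun τ => by
      simpa [kink_eq_profile, Function.comp_def] using
        (tendsto_profile_atTop.comp (ht τ)).sub_const 1
    have h1 : ∀ τ, Tendsto (fun z => bell (z - τ) - 0) atTop (𝓝 0) := fun τ => by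
      simpa [Function.comp_def] using tendsto_bell_atTop.comp (ht τ)
    exact tendsto_dist_phase (isJet_kink τ₁).deriv_eq (isJet_kink τ₂).deriv_eq
      (isJet_const _).deriv_eq (isJet_const _).deriv_eq (h0 τ₁) (h1 τ₁) (h0 τ₂) (h1 τ₂)

lemma IsJet.neg_comp_neg {f f1 f2 : ℝ → ℝ} (h : IsJet f f1 f2) :
    IsJet (fun z => -f (-z)) (fun z => f1 (-z)) fun z => -f2 (-z) := by
  refine ⟨fun z => ?_, fun z => ?_, ?_⟩
  · simpa [Function.comp_def] using ((h.1 (-z)).scomp z (hasDerivAt_neg z)).fun_neg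
  · simpa [Function.comp_def] using (h.2.1 (-z)).scomp z (hasDerivAt_neg z)
  · have := h.2.2
    fun_prop

/-- Reversibility: the wave system is invariant under `(U, V)(z) ↦ (-V(-z), -U(-z))`. -/
lemma IsHalfWave.reverse {lamM lamM' lamE lamE' γ Ω p ε : ℝ} {U U1 U2 V V2 : ℝ → ℝ}
    (h : IsHalfWave lamM lamM' lamE lamE' γ Ω p ε U U1 U2 V V2) :
    IsHalfWave lamM lamM' lamE lamE' (-γ) Ω (-p) ε (fun z => -U (-z)) (fun z => U1 (-z))
      (fun z => -U2 (-z)) (fun z => -V (-z)) fun z => -V2 (-z) := by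
  intro z
  have e := h (-z)
  have e1 : -(z - -p) = -z - p := by ring
  simp only [e1]
  rw [mul_neg, Real.sin_neg] at e
  linear_combination -e

/-- A reversible wave that stays close to a kink is heteroclinic between periodic waves. -/
lemma exists_periodic_of_reversible {lamM lamM' lamE lamE' γ Ω p ε : ℝ} {U U1 U2 : ℝ → ℝ}
    (hΩ : 0 < Ω) (hU : IsJet U U1 U2)
    (h : IsHalfWave lamM lamM' lamE lamE' γ Ω p ε U U1 U2 (fun z => -U (-z)) fun z => -U2 (-z))
    (hε : |ε| * (|lamM| + |lamM'| + |lamE| + |lamE'| + |γ|) ≤ 1 / 40) {m τ δ : ℝ} (hδ : 0 < δ)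
    (hm : ∀ z, |U2 z| ≤ m) (hk : ∀ z, |U z - kink τ z| ≤ min δ (1 / 400) / 2)
    (hk1 : ∀ z, |U1 z - bell (z - τ)| ≤ min δ (1 / 400) / 2) :
    ∃ Pm Qm Pp Qp : ℝ → ℝ,
      IsHeteroclinicWave 0 (-1) lamM lamM' lamE lamE' γ Ω p ε Pm Qm Pp Qp U (fun z => -U (-z)) ∧
      (∀ z : ℝ, dist (phase Pm Qm z) (0, -1, 0, -1) < δ) ∧
      (∀ z : ℝ, dist (phase Pp Qp z) (0, 1, 0, 1) < δ) ∧
      (∀ z : ℝ, dist (phase U (fun z => -U (-z)) z) (phase (kink τ) (kink (-τ)) z) < δ) := by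
  set μ := min δ (1 / 400) with hμ
  have hμ0 : 0 < μ := lt_min hδ (by norm_num)
  have hμδ : μ ≤ δ := min_le_left _ _
  have hμ1 : μ ≤ 1 / 400 := min_le_right _ _
  have hT : 0 < 2 * Real.pi / Ω := by positivity
  have hV := hU.neg_comp_neg
  have hr := h.reverse
  simp only [neg_neg] at hr
  have ht : ∀ τ : ℝ, Tendsto (fun z : ℝ => z - τ) atTop atTop := fun τ =>
    tendsto_atTop_add_const_right _ _ tendsto_id
  have hkV : ∀ z, |-U (-z) - kink (-τ) z| ≤ μ / 2 := fun z => by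
    have := hk (-z)
    rw [kink_eq_profile] at this ⊢
    rw [show z - -τ = -(-z - τ) by ring, profile_neg, ← abs_neg]
    convert this using 2
    ring
  have hkV1 : ∀ z, |U1 (-z) - bell (z - -τ)| ≤ μ / 2 := fun z => by
    have := hk1 (-z)
    rwa [show z - -τ = -(-z - τ) by ring, bell_neg]
  have hnear : ∀ᶠ z in atTop, |kink τ z - 1| < μ / 4 ∧ |kink (-τ) z - 1| < μ / 4 ∧
      |bell (z - τ)| < μ / 4 ∧ |bell (z - -τ)| < μ / 4 := by
    have h1 : ∀ τ, ∀ᶠ z in atTop, |kink τ z - 1| < μ / 4 := fun τ => by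
      have := ((tendsto_profile_atTop.comp (ht τ)).sub_const 1).abs
      simp only [sub_self, abs_zero] at this
      exact this.eventually_lt_const (by positivity)
    have h2 : ∀ τ, ∀ᶠ z in atTop, |bell (z - τ)| < μ / 4 := fun τ => by
      have := (tendsto_bell_atTop.comp (ht τ)).abs
      simp only [abs_zero] at this
      exact this.eventually_lt_const (by positivity)
    filter_upwards [h1 τ, h1 (-τ), h2 τ, h2 (-τ)] with z a b c d using ⟨a, b, c, d⟩
  obtain ⟨S, hS⟩ := eventually_atTop.1 hnear
  have tri : ∀ {a b c x y : ℝ}, |a - b| ≤ x → |b - c| < y → |a - c| ≤ x + y := fun {a b c} _ _ h h' =>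
    (abs_sub_le a b c).trans (add_le_add h h'.le)
  have cU : ∀ z, S ≤ z → |U z - 1| ≤ 3 * μ / 4 := fun z hz => by
    linarith [tri (hk z) (hS z hz).1]
  have cV : ∀ z, S ≤ z → |-U (-z) - 1| ≤ 3 * μ / 4 := fun z hz => by
    linarith [tri (hkV z) (hS z hz).2.1]
  have cU1 : ∀ z, S ≤ z → |U1 z - 0| ≤ 3 * μ / 4 := fun z hz => by
    have h0 := (hS z hz).2.2.1
    rw [← sub_zero (bell _)] at h0
    linarith [tri (hk1 z) h0]
  have cV1 : ∀ z, S ≤ z → |U1 (-z) - 0| ≤ 3 * μ / 4 := fun z hz => by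
    have h0 := (hS z hz).2.2.2
    rw [← sub_zero (bell _)] at h0
    linarith [tri (hkV1 z) h0]
  have hbU : ∀ z, |U z| ≤ max m 2 ∧ |U1 z| ≤ max m 2 ∧ |U2 z| ≤ max m 2 := fun z => by
    have h1 := abs_le.1 (hk z)
    have h2 := abs_le.1 (abs_profile_le (z - τ))
    have h3 := abs_le.1 (hk1 z)
    have h4 := abs_le.1 (abs_bell_le (z - τ))
    rw [kink_eq_profile] at h1
    refine ⟨le_trans ?_ (le_max_right _ _), le_trans ?_ (le_max_right _ _),
      (hm z).trans (le_max_left _ _)⟩ <;> rw [abs_le] <;> constructor <;>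
      linarith [h1.1, h1.2, h2.1, h2.2, h3.1, h3.2, h4.1, h4.2]
  obtain ⟨⟨aU, aU1, aU2⟩, aV, aV1, aV2⟩ := asymptoticallyPeriodic_of_isHalfWave hΩ hU hV h hr hε
    (fun z hz => (cU z hz).trans (by linarith)) (fun z hz => (cV z hz).trans (by linarith)) hbU
    (fun z => by simpa using hbU (-z))
  set T := 2 * Real.pi / Ω
  set P := periodicLimit T U with hP
  set P1 := periodicLimit T U1 with hP1
  set P2 := periodicLimit T U2 with hP2
  set Q := periodicLimit T (fun z => -U (-z)) with hQ
  set Q1 := periodicLimit T (fun z => U1 (-z)) with hQ1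
  set Q2 := periodicLimit T (fun z => -U2 (-z)) with hQ2
  have jP : IsJet P P1 P2 := ⟨aU.hasDerivAt aU1 hT hU.1, aU1.hasDerivAt aU2 hT hU.2.1,
    aU2.continuous hT hU.2.2⟩
  have jQ : IsJet Q Q1 Q2 := ⟨aV.hasDerivAt aV1 hT hV.1, aV1.hasDerivAt aV2 hT hV.2.1,
    aV2.continuous hT hV.2.2⟩
  have wP : IsHalfWave lamM lamM' lamE lamE' γ Ω p ε P P1 P2 Q Q2 := h.periodicLimit hΩ aU aU1 aU2 aV aV2
  have wQ : IsHalfWave lamM lamM' lamE lamE' (-γ) Ω (-p) ε Q Q1 Q2 P P2 :=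
    hr.periodicLimit hΩ aV aV1 aV2 aU aU2
  have wP' := wP.reverse
  have wQ' := wQ.reverse
  simp only [neg_neg] at wP' wQ'
  have pneg : ∀ {f : ℝ → ℝ}, Function.Periodic f T → Function.Periodic (fun z => -f (-z)) T :=
    fun {f} hf z => by
      have := hf (-(z + T))
      rw [show -(z + T) + T = -z by ring] at this
      simp only [this]
  have near : ∀ {f : ℝ → ℝ} {c : ℝ}, AsymptoticallyPeriodic T f →
      (∀ z, S ≤ z → |f z - c| ≤ 3 * μ / 4) → ∀ z, |periodicLimit T f z - c| < δ := by
    intro f c hf hc z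
    have : |periodicLimit T f z - c| ≤ 3 * μ / 4 := by
      refine le_of_tendsto ((hf.tendsto hT z).sub_const c).abs ?_
      have hz : Tendsto (fun n : ℕ => z + n * T) atTop atTop :=
        tendsto_atTop_add_const_left _ _ (tendsto_natCast_atTop_atTop.atTop_mul_const hT)
      filter_upwards [hz.eventually_ge_atTop S] with n hn using hc _ hn
    linarith
  have nP := near aU cU
  have nP1 := near aU1 cU1
  have nQ := near aV cV
  have nQ1 := near aV1 cV1
  have nneg : ∀ {x : ℝ}, |x - 1| < δ → |-x - -1| < δ := fun {x} hx => by
    rwa [← abs_neg, show -(-x - -1) = x - 1 by ring]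
  have tneg : ∀ {f : ℝ → ℝ}, Tendsto f atTop (𝓝 0) → Tendsto (fun z => f (-z)) atBot (𝓝 0) :=
    fun hf => hf.comp tendsto_neg_atBot_atTop
  -- The periodic pair at `-∞` is the reversal of the pair `(P, Q)` found at `+∞`; reversal
  -- exchanges the two components.
  refine ⟨fun z => -Q (-z), fun z => -P (-z), P, Q, ⟨⟨?_, pneg (aV.periodic hT), pneg (aU.periodic hT)⟩,
    ⟨isWaveSolution_of_isHalfWave jP jQ wP wQ, aU.periodic hT, aV.periodic hT⟩,
    isWaveSolution_of_isHalfWave hU hV h hr, ?_, ?_⟩, fun z => ?_, fun z => ?_, fun z => ?_⟩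
  · exact isWaveSolution_of_isHalfWave jQ.neg_comp_neg jP.neg_comp_neg wQ' wP'
  · refine tendsto_dist_phase hU.deriv_eq hV.deriv_eq jQ.neg_comp_neg.deriv_eq
      jP.neg_comp_neg.deriv_eq ?_ ?_ ?_ ?_
    · refine (neg_zero (G := ℝ) ▸ (tneg (aV.tendsto_sub hT)).neg).congr fun z => ?_
      simp only [neg_neg]; ring
    · refine (tneg (aV1.tendsto_sub hT)).congr fun z => ?_
      simp only [neg_neg]; rfl
    · refine (neg_zero (G := ℝ) ▸ (tneg (aU.tendsto_sub hT)).neg).congr fun z => ?_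
      ring
    · exact tneg (aU1.tendsto_sub hT)
  · exact tendsto_dist_phase hU.deriv_eq hV.deriv_eq jP.deriv_eq jQ.deriv_eq (aU.tendsto_sub hT)
      (aU1.tendsto_sub hT) (aV.tendsto_sub hT) (aV1.tendsto_sub hT)
  · exact dist_phase_lt jQ.neg_comp_neg.deriv_eq jP.neg_comp_neg.deriv_eq (nQ1 (-z)) (nneg (nQ (-z)))
      (nP1 (-z)) (nneg (nP (-z)))
  · exact dist_phase_lt jP.deriv_eq jQ.deriv_eq (nP1 z) (nP z) (nQ1 z) (nQ z)
  · have hlt : μ / 2 < δ := by linarith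
    rw [phase.eq_1 (kink τ), (isJet_kink τ).deriv_eq, (isJet_kink (-τ)).deriv_eq]
    exact dist_phase_lt hU.deriv_eq hV.deriv_eq ((hk1 z).trans_lt hlt) ((hk z).trans_lt hlt)
      ((hkV1 z).trans_lt hlt) ((hkV z).trans_lt hlt)

theorem theorem2 (lamM lamM' lamE lamE' γ Ω p : ℝ) (hΩ : 0 < Ω)
    (h : (0 < |(lamE + lamE') - √2 * γ / 3| ∧
            |(lamE + lamE') - √2 * γ / 3| <
              (Ω * Real.pi / √2) * (Real.sinh (Ω * Real.pi / √2))⁻¹) ∨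
         (0 < |-(lamE + lamE') - √2 * γ / 3| ∧
            |-(lamE + lamE') - √2 * γ / 3| <
              (Ω * Real.pi / √2) * (Real.sinh (Ω * Real.pi / √2))⁻¹)) :
    (∀ τ₁ τ₂ : ℝ, IsHeteroclinicWave 0 (-1) lamM lamM' lamE lamE' γ Ω p 0
        (fun _ => -1) (fun _ => -1) (fun _ => 1) (fun _ => 1) (kink τ₁) (kink τ₂)) ∧
    ∃ τ₁ τ₂ : ℝ, ∀ δ : ℝ, 0 < δ → ∃ ε₀ : ℝ, 0 < ε₀ ∧ ∀ ε : ℝ, ε ≠ 0 → |ε| < ε₀ →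
      ∃ Pm Qm Pp Qp U V : ℝ → ℝ,
        IsHeteroclinicWave 0 (-1) lamM lamM' lamE lamE' γ Ω p ε Pm Qm Pp Qp U V ∧
        (∀ z : ℝ, dist (phase Pm Qm z) (0, -1, 0, -1) < δ) ∧
        (∀ z : ℝ, dist (phase Pp Qp z) (0, 1, 0, 1) < δ) ∧
        (∀ z : ℝ, dist (phase U V z) (phase (kink τ₁) (kink τ₂) z) < δ) := by
  refine ⟨fun τ₁ τ₂ => isHeteroclinicWave_kink _ _ _ _ _ _ _ _ _, ?_⟩
  obtain ⟨τ, hM, hJ⟩ := exists_simple_melnikov_zero lamM lamM' lamE lamE' γ p hΩ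
    (h.imp And.right And.right)
  obtain ⟨R, ε₁, hR, hε₁, hsol⟩ := exists_corrected_kink _ _ hM hJ
  refine ⟨τ, -τ, fun δ hδ => ?_⟩
  set Λ := |lamM| + |lamM'| + |lamE| + |lamE'| + |γ| with hΛ
  have hΛ0 : 0 ≤ Λ := by positivity
  have hμ0 : 0 < min δ (1 / 400) := lt_min hδ (by norm_num)
  -- The three bounds serve the solvability of the reduced problem, the smallness of the coupling in
  -- the hyperbolic estimate, and the closeness to the kink, since `w` and `w'` are bounded by `R`.
  refine ⟨min ε₁ (min (1 / (40 * (Λ + 1))) (min δ (1 / 400) / (2 * R))), by positivity,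
    fun ε _ hε => ?_⟩
  obtain ⟨h1, h2, h3⟩ := lt_min_iff.1 hε |>.imp_right lt_min_iff.1
  rw [lt_div_iff₀ (by positivity)] at h2 h3
  obtain ⟨w, w1, w2, hw, hw1, hd, hd1, heq⟩ := hsol ε h1
  set U : ℝ → ℝ := fun z => kink τ z + ε * w (z - τ) with hU
  set U1 : ℝ → ℝ := fun z => bell (z - τ) + ε * w1 (z - τ) with hU1
  set U2 : ℝ → ℝ := fun z => slopeB (z - τ) + ε * w2 (z - τ) with hU2
  have hjet : IsJet U U1 U2 := by
    refine ⟨fun z => ((isJet_kink τ).1 z).add (((hd (z - τ)).comp_sub_const z τ).const_mul ε),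
      fun z => ((isJet_kink τ).2.1 z).add (((hd1 (z - τ)).comp_sub_const z τ).const_mul ε), ?_⟩
    have := slopeB.continuous
    have := w2.continuous
    fun_prop
  have hhalf : IsHalfWave lamM lamM' lamE lamE' γ Ω p ε U U1 U2 (fun z => -U (-z))
      fun z => -U2 (-z) := by
    intro z
    have e := heq (z - τ)
    have e0 : profileJet + ε • (w, w1, w2) =
        (profileB + ε • w, bellB + ε • w1, slopeB + ε • w2) := rfl
    rw [e0, couplingOp_apply, sineB_apply] at e
    -- In the centred coordinate, the points `-(z - p)` and `-z` at which `V = -U(-·)` samples `U`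
    -- become the reflections with parameters `p - 2τ` and `-2τ`.
    have e1 : p - 2 * τ - (z - τ) = -(z - p) - τ := by ring
    have e2 : -2 * τ - (z - τ) = -z - τ := by ring
    rw [e1, e2, sub_add_cancel] at e
    simp only [BoundedContinuousFunction.add_apply, BoundedContinuousFunction.coe_smul, smul_eq_mul,
      profileB_apply, bellB_apply] at e
    simp only [hU, hU1, hU2, kink_eq_profile]
    rw [e]
    ring
  have hsmall : ∀ x : ℝ, |x| ≤ R → |ε * x| ≤ min δ (1 / 400) / 2 := fun x hx => by
    rw [abs_mul]
    have := mul_le_mul_of_nonneg_left hx (abs_nonneg ε)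
    linarith
  obtain ⟨Pm, Qm, Pp, Qp, hres⟩ := exists_periodic_of_reversible (τ := τ) (m := ‖slopeB + ε • w2‖)
    hΩ hjet hhalf (by nlinarith [abs_nonneg ε]) hδ
    (fun z => (slopeB + ε • w2).norm_coe_le_norm (z - τ))
    (fun z => by
      simp only [hU, add_sub_cancel_left]
      exact hsmall _ ((w.norm_coe_le_norm _).trans hw))
    (fun z => by
      simp only [hU1, add_sub_cancel_left]
      exact hsmall _ ((w1.norm_coe_le_norm _).trans hw1))
  exact ⟨Pm, Qm, Pp, Qp, U, fun z => -U (-z), hres⟩
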